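/- Let $q\ge 2$ be an integer, let $a\ge 0$ and $b>0$ be real numbers, and put $$d=\frac{a+(q-1)b}{q},\qquad \lambda=\frac{a-b}{a+(q-1)b}\in\Big[-\frac1{q-1},1\Big).$$ **Block model.** $\mathcal G(n,q,\frac an,\frac bn)$ (for $n$ large enough that $\frac an,\frac bn\le 1$) is the random graph $G$ on $[n]$ obtained by giving the vertices independent uniform labels $\sigma(u)\in[q]$ and then, given $\sigma$, including each pair $\{u,v\}$ independently as an edge, with probability $\frac an$ if $\sigma(u)=\sigma(v)$ and $\frac bn$ otherwise. An estimator is a family of functions assigning to every graph $G$ on $[n]$ (for every $n$) a labelling $\hat\sigma=\hat\sigma(G):[n]\to[q]$. Detection is possible if there are $\epsilon>0$ and an estimator $\hat\sigma$ with $$\limsup_{n\to\infty}\frac1n\,\mathbb E\Big[\max_{\Gamma\in S_q}\big|\{i:\hat\sigma(i)=\Gamma(\sigma(i))\}\big|\Big]\ge\frac1q+\epsilon .$$ **Broadcast model.** On a locally finite rooted tree $T$ with root $\rho$, the spin $\sigma_\rho$ is uniform on $[q]$, and each vertex $u$ with parent $v$ takes, given the spins of the vertices outside the subtree of $u$, the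 spin $j$ with probability $\lambda+\frac{1-\lambda}q$ if $j=\sigma_v$ and $\frac{1-\lambda}q$ otherwise. Let $\sigma^i(n)$ denote the spins at distance $n$ from $\rho$ conditioned on $\sigma_\rho=i$. There is nonreconstruction at $\lambda$ for $T$ if $\limsup_{n\to\infty}d_{\mathrm{TV}}(\sigma^i(n),\sigma^j(n))=0$ for all $i,j\in[q]$. **Theorem.** If there is nonreconstruction at $\lambda$ for almost every Galton–Watson tree $T$ with Poisson$(d)$ offspring distribution, then detection is information-theoretically impossible in $\mathcal G(n,q,\frac an,\frac bn)$: detection is not possible, and every estimator $\hat\sigma$ satisfies $$\limsup_{n\to\infty}\frac1n\,\mathbb E\Big[\max_{\Gamma\in S_q}\big|\{i:\hat\sigma(i)=\Gamma(\sigma(i))\}\big|\Big]=\frac1q .$$ -/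

import Mathlib

open MeasureTheory ProbabilityTheory Filter
open scoped Classical BigOperators NNReal

noncomputable section

/-! ### The stochastic block model and detection -/

/-- The probability that the pair `(σ, G)` of labels and graph occurs in the stochastic block model
`G(n, q, pin, pout)`: the labels are independent and uniform on `Fin q`, and given the labels each
pair `u < v` of vertices is, independently of the others, an edge with probability `pin` if
`σ u = σ v` and `pout` otherwise. (The weights are nonnegative as soon as `pin, pout ∈ [0, 1]`.) -/
def sbmProb (n q : ℕ) (pin pout : ℝ) (σ : Fin n → Fin q) (G : SimpleGraph (Fin n)) : ℝ :=
  ((1 : ℝ) / q) ^ n *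
    ∏ e : Fin n × Fin n with e.1 < e.2,
      let p := if σ e.1 = σ e.2 then pin else pout
      if G.Adj e.1 e.2 then p else 1 - p

/-- Expectation of `f (σ, G)` under the stochastic block model. -/
def sbmExpectation (n q : ℕ) (pin pout : ℝ)
    (f : (Fin n → Fin q) → SimpleGraph (Fin n) → ℝ) : ℝ :=
  ∑ σ : Fin n → Fin q, ∑ G : SimpleGraph (Fin n), sbmProb n q pin pout σ G * f σ G

/-- `max_Γ |{i : s i = Γ (σ i)}|`, the maximum being over all permutations `Γ` of the labels. -/
def maxAgreement {n q : ℕ} (s σ : Fin n → Fin q) : ℕ :=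
  Finset.univ.sup fun Γ : Equiv.Perm (Fin q) =>
    (Finset.univ.filter fun i : Fin n => s i = Γ (σ i)).card

/-- An estimator of the labels: for every `n`, a function of the graph on `n` vertices alone. -/
abbrev Estimator (q : ℕ) : Type :=
  (n : ℕ) → SimpleGraph (Fin n) → Fin n → Fin q

/-- The expected overlap `(1/n) E[max_Γ |{i : σ̂(i) = Γ(σ(i))}|]` of an estimator in
`G(n, q, a/n, b/n)`. -/
def expectedOverlap (q : ℕ) (a b : ℝ) (est : Estimator q) (n : ℕ) : ℝ :=
  (1 / (n : ℝ)) *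
    sbmExpectation n q (a / n) (b / n) fun σ G => (maxAgreement (est n G) σ : ℝ)

/-- Detection is possible for `G(n, q, a/n, b/n)`. -/
def DetectionPossible (q : ℕ) (a b : ℝ) : Prop :=
  ∃ ε : ℝ, 0 < ε ∧ ∃ est : Estimator q,
    1 / (q : ℝ) + ε ≤ limsup (fun n : ℕ => expectedOverlap q a b est n) atTop

/-! ### Rooted trees and the broadcast model

A locally finite rooted tree is encoded by the numbers of children of its vertices. Vertices are
words in `ℕ`: the root is `[]`, and the children of the vertex `u` are `k :: u` for
`k < N u`. -/

/-- The set of vertices at distance `n` from the root. -/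
def treeLevel (N : List ℕ → ℕ) : ℕ → Finset (List ℕ)
  | 0 => {[]}
  | n + 1 => (treeLevel N n).biUnion fun u => (Finset.range (N u)).image fun k => k :: u

/-- The set of vertices at distance at most `n` from the root. -/
def treeBall (N : List ℕ → ℕ) (n : ℕ) : Finset (List ℕ) :=
  (Finset.range (n + 1)).biUnion (treeLevel N)

theorem treeLevel_subset_treeBall (N : List ℕ → ℕ) {m n : ℕ} (h : m ≤ n) :
    treeLevel N m ⊆ treeBall N n :=
  Finset.subset_biUnion_of_mem (treeLevel N) (Finset.mem_range.2 (Nat.lt_succ_of_le h))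

theorem root_mem_treeBall (N : List ℕ → ℕ) (n : ℕ) : [] ∈ treeBall N n :=
  treeLevel_subset_treeBall N (Nat.zero_le n) (Finset.mem_singleton_self _)

/-- Transition matrix of the `q`-state symmetric channel with second eigenvalue `lam`. -/
def channel (q : ℕ) (lam : ℝ) (i j : Fin q) : ℝ :=
  if i = j then lam + (1 - lam) / q else (1 - lam) / q

/-- The broadcast model on the first `n` levels of the tree: the probability of the spin
configuration `σ`, where the root spin is uniform and the spin of every other vertex is drawn
from the row of the channel given by the spin of its parent. The product is over all pairs
(parent, child). -/
def broadcastProb (q : ℕ) (lam : ℝ) (N : List ℕ → ℕ) (n : ℕ) (σ : treeBall N n → Fin q) : ℝ :=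
  ((1 : ℝ) / q) *
    ∏ e : treeBall N n × treeBall N n with ∃ k : ℕ, e.2.1 = k :: e.1.1,
      channel q lam (σ e.1) (σ e.2)

/-- The law of `σ(n)`, the spins at distance `n` from the root, conditioned on the root spin
being `i`. -/
def levelLaw (q : ℕ) (lam : ℝ) (N : List ℕ → ℕ) (n : ℕ) (i : Fin q)
    (τ : treeLevel N n → Fin q) : ℝ :=
  (∑ σ : treeBall N n → Fin q with
      σ ⟨[], root_mem_treeBall N n⟩ = i ∧
        ∀ v : treeLevel N n, σ ⟨v.1, treeLevel_subset_treeBall N le_rfl v.2⟩ = τ v,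
      broadcastProb q lam N n σ) /
    ∑ σ : treeBall N n → Fin q with σ ⟨[], root_mem_treeBall N n⟩ = i,
      broadcastProb q lam N n σ

/-- Total variation distance of two probability mass functions on a finite type. -/
def tvDist {α : Type*} [Fintype α] (p r : α → ℝ) : ℝ :=
  (1 / 2) * ∑ x, |p x - r x|

/-- The reconstruction problem is solvable on the tree `N`. -/
def ReconstructionSolvable (q : ℕ) (lam : ℝ) (N : List ℕ → ℕ) : Prop :=
  ∃ i j : Fin q,
    0 < limsup (fun n : ℕ => tvDist (levelLaw q lam N n i) (levelLaw q lam N n j)) atTop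

/-- Nonreconstruction on the tree `N`. -/
def Nonreconstruction (q : ℕ) (lam : ℝ) (N : List ℕ → ℕ) : Prop :=
  ¬ ReconstructionSolvable q lam N

/-- The Galton-Watson tree with Poisson(`d`) offspring: the numbers of children of the vertices
are independent Poisson(`d`) variables. -/
def poissonGW (d : ℝ≥0) : Measure (List ℕ → ℕ) :=
  Measure.infinitePi fun _ : List ℕ => poissonMeasure d

end

/-! It suffices that, for all vertices u ≠ v and labels i, j, t, the signed law of the graph with
density proportional to (1{σ_u = i} - 1{σ_u = j}) 1{σ_v = t} has small total variation norm,
uniformly in u and v. Then, for any estimator, the agreements at two distinct vertices are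
asymptotically uncorrelated, so the number of agreements minus n/q has second moment o(n²). Since
the number of permutations Γ does not depend on n, the overlap is at most 1/q + o(1); it is at least
1/q by averaging over cyclic shifts (`tendsto_expectedOverlap`).

To bound the norm, the graph is explored from u. One step reveals the pairs meeting the current
level, and their joint law with the labels is compared, through the Hellinger affinity, with an
ideal forest in which every remaining vertex attaches to at most one vertex of the level
(`labelAvg_sum_abs_sub_le`). Given the attachment, the labels of the old level can be integrated out
(`graphNorm_attach`). What remains is a quantity of the same kind on a smaller graph, with the
signed weight pushed through the channel to the next level, and the sum over attachments is
dominated by an expectation over Poisson offspring (`sum_attachments_le`). The label of v is carried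
along as an inert factor. The norm `forestNorm` is a supremum over embeddings of the level, so it
depends only on the abstract tree and the step can be iterated (`forestNorm_le_step`,
`forestNorm_le_explored`).

After a fixed number m of levels, the errors vanish as n → ∞ and the main term is at most twice the
expected total variation distance between the level-m laws of the broadcast model started from i and
from j. Nonreconstruction and dominated convergence make it vanish as m → ∞
(`tendsto_forestNorm_rootState`). -/

noncomputable section

/-! ### Averages over uniform labels -/

/-- Average of `f` over uniform labels. -/
def labelAvg {n q : ℕ} (f : (Fin n → Fin q) → ℝ) : ℝ :=
  ((1 : ℝ) / q) ^ n * ∑ σ, f σ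

section LabelAvg

variable {n q : ℕ}

theorem labelAvg_mono {f g : (Fin n → Fin q) → ℝ} (h : ∀ σ, f σ ≤ g σ) :
    labelAvg f ≤ labelAvg g := by
  unfold labelAvg
  gcongr with σ
  exact h σ

theorem labelAvg_add (f g : (Fin n → Fin q) → ℝ) :
    labelAvg (fun σ => f σ + g σ) = labelAvg f + labelAvg g := by
  simp only [labelAvg, Finset.sum_add_distrib, mul_add]

theorem labelAvg_const_mul (c : ℝ) (f : (Fin n → Fin q) → ℝ) :
    labelAvg (fun σ => c * f σ) = c * labelAvg f := by
  simp only [labelAvg, ← Finset.mul_sum]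
  ring

theorem labelAvg_sum {ι : Type*} (s : Finset ι) (f : ι → (Fin n → Fin q) → ℝ) :
    labelAvg (fun σ => ∑ i ∈ s, f i σ) = ∑ i ∈ s, labelAvg (f i) := by
  simp only [labelAvg, ← Finset.mul_sum]
  rw [Finset.sum_comm]

theorem abs_labelAvg_le (f : (Fin n → Fin q) → ℝ) :
    |labelAvg f| ≤ labelAvg fun σ => |f σ| := by
  unfold labelAvg
  rw [abs_mul, abs_of_nonneg (by positivity : (0 : ℝ) ≤ (1 / q) ^ n)]
  gcongr
  exact Finset.abs_sum_le_sum_abs _ _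

theorem labelAvg_const (hq : q ≠ 0) (c : ℝ) : labelAvg (fun _ : Fin n → Fin q => c) = c := by
  have : (q : ℝ) ≠ 0 := by exact_mod_cast hq
  simp [labelAvg, this]

/-- Resampling one label does not change the average. -/
theorem labelAvg_update (hq : q ≠ 0) (F : (Fin n → Fin q) → ℝ) (y : Fin n) :
    labelAvg F = labelAvg fun σ => (1 / (q : ℝ)) * ∑ c, F (Function.update σ y c) := by
  have hq' : (q : ℝ) ≠ 0 := by exact_mod_cast hq
  -- Exchanging the label of `y` with a fresh independent one is a measure-preserving bijection.
  have hinv : Function.Involutive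
      (fun x : (Fin n → Fin q) × Fin q => (Function.update x.1 y x.2, x.1 y)) := by
    rintro ⟨σ, c⟩
    simp
  have h := Equiv.sum_comp hinv.toPerm (fun x : (Fin n → Fin q) × Fin q => F x.1)
  rw [Fintype.sum_prod_type, Fintype.sum_prod_type] at h
  simp only [Function.Involutive.coe_toPerm, Finset.sum_const, Finset.card_univ,
    Fintype.card_fin, nsmul_eq_mul] at h
  simp only [labelAvg, ← Finset.mul_sum]
  rw [h, ← Finset.mul_sum]
  field_simp

/-- Resampling the labels of finitely many vertices does not change the average. -/
theorem labelAvg_extend {ι : Type*} [Fintype ι] [DecidableEq ι] (hq : q ≠ 0) (φ : ι → Fin n)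
    (hφ : Function.Injective φ) (F : (Fin n → Fin q) → ℝ) :
    labelAvg F = labelAvg fun σ =>
      (1 / (q : ℝ)) ^ Fintype.card ι * ∑ s : ι → Fin q, F (Function.extend φ s σ) := by
  have hq' : (q : ℝ) ≠ 0 := by exact_mod_cast hq
  have hinv : Function.Involutive
      (fun x : (Fin n → Fin q) × (ι → Fin q) => (Function.extend φ x.2 x.1, x.1 ∘ φ)) := by
    rintro ⟨σ, s⟩
    refine Prod.ext ?_ ?_
    · funext x
      by_cases hx : ∃ u, φ u = x
      · obtain ⟨u, rfl⟩ := hx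
        simp [hφ.extend_apply]
      · simp [Function.extend_apply' _ _ _ hx]
    · funext u
      simp [hφ.extend_apply]
  have h := Equiv.sum_comp hinv.toPerm (fun x : (Fin n → Fin q) × (ι → Fin q) => F x.1)
  rw [Fintype.sum_prod_type, Fintype.sum_prod_type] at h
  simp only [Function.Involutive.coe_toPerm, Finset.sum_const, Finset.card_univ,
    Fintype.card_fin, nsmul_eq_mul, Fintype.card_pi, Finset.prod_const, Nat.cast_pow] at h
  simp only [labelAvg, ← Finset.mul_sum]
  rw [h, ← Finset.mul_sum]
  congr 1
  rw [one_div, inv_pow, inv_mul_cancel_left₀ (pow_ne_zero _ hq')]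

/-- Average of a product of functions, the factor of index `y` having a constant average over the
label of `y` and the other factors not depending on this label. -/
theorem labelAvg_prod (hq : q ≠ 0) (g : Fin n → (Fin n → Fin q) → ℝ) (m : Fin n → ℝ)
    (Y : Finset (Fin n))
    (hind : ∀ y ∈ Y, ∀ y' ∈ Y, y' ≠ y → ∀ σ c, g y (Function.update σ y' c) = g y σ)
    (hm : ∀ y ∈ Y, ∀ σ, (1 / (q : ℝ)) * ∑ c, g y (Function.update σ y c) = m y) :
    labelAvg (fun σ => ∏ y ∈ Y, g y σ) = ∏ y ∈ Y, m y := by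
  induction Y using Finset.induction_on with
  | empty => simpa using labelAvg_const hq 1
  | insert y Y hy ih =>
    rw [Finset.prod_insert hy, ← ih
      (fun z hz z' hz' => hind z (Finset.mem_insert_of_mem hz) z' (Finset.mem_insert_of_mem hz'))
      (fun z hz => hm z (Finset.mem_insert_of_mem hz)), labelAvg_update hq _ y,
      ← labelAvg_const_mul]
    congr 1
    funext σ
    rw [← hm y (Finset.mem_insert_self _ _) σ, mul_assoc, Finset.sum_mul]
    congr 1
    refine Finset.sum_congr rfl fun c _ => ?_
    rw [Finset.prod_insert hy]
    congr 1
    refine Finset.prod_congr rfl fun z hz => ?_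
    refine hind z (Finset.mem_insert_of_mem hz) y (Finset.mem_insert_self _ _) ?_ σ c
    rintro rfl
    exact hy hz

/-- Jensen's inequality, from the tangent line of the exponential at the mean. It reduces the lower
bound on the affinity to the average of a linear expression. -/
theorem exp_labelAvg_le (hq : q ≠ 0) (X : (Fin n → Fin q) → ℝ) :
    Real.exp (labelAvg X) ≤ labelAvg fun σ => Real.exp (X σ) := by
  set μ := labelAvg X with hμ
  have h : labelAvg (fun σ => Real.exp μ * (1 - μ) + Real.exp μ * X σ) = Real.exp μ := by
    rw [labelAvg_add, labelAvg_const hq, labelAvg_const_mul, ← hμ]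
    ring
  calc Real.exp μ = _ := h.symm
    _ ≤ _ := labelAvg_mono fun σ => by
      have := Real.add_one_le_exp (X σ - μ)
      have h2 : Real.exp (X σ) = Real.exp μ * Real.exp (X σ - μ) := by
        rw [← Real.exp_add]; ring_nf
      rw [h2]
      nlinarith [Real.exp_pos μ]

end LabelAvg

/-! ### Partially observed block models -/

/-- Connection probability of two vertices with labels `i` and `j`. -/
def edgeProb {q : ℕ} (pin pout : ℝ) (i j : Fin q) : ℝ :=
  if i = j then pin else pout

/-- Probability, given the labels, that among the pairs in `Z` exactly those in `H` are edges. -/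
def edgeWeight {n q : ℕ} (pin pout : ℝ) (Z H : Finset (Fin n × Fin n)) (σ : Fin n → Fin q) : ℝ :=
  ∏ e ∈ Z, if e ∈ H then edgeProb pin pout (σ e.1) (σ e.2)
    else 1 - edgeProb pin pout (σ e.1) (σ e.2)

/-- Total variation norm of the signed law of the graph on the pairs `Z`, the labels having
density `A` with respect to the uniform law. -/
def graphNorm {n q : ℕ} (pin pout : ℝ) (Z : Finset (Fin n × Fin n))
    (A : (Fin n → Fin q) → ℝ) : ℝ :=
  ∑ H ∈ Z.powerset, |labelAvg fun σ => A σ * edgeWeight pin pout Z H σ|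

/-- The pairs of vertices of `U`. -/
def pairsIn {n : ℕ} (U : Finset (Fin n)) : Finset (Fin n × Fin n) :=
  Finset.univ.filter fun e => e.1 < e.2 ∧ e.1 ∈ U ∧ e.2 ∈ U

theorem mem_pairsIn {n : ℕ} {U : Finset (Fin n)} {e : Fin n × Fin n} :
    e ∈ pairsIn U ↔ e.1 < e.2 ∧ e.1 ∈ U ∧ e.2 ∈ U := by
  simp [pairsIn]

theorem Finset.sum_powerset_union {α : Type*} [DecidableEq α] {Z₁ Z₂ : Finset α} (h : Disjoint Z₁ Z₂)
    (f : Finset α → ℝ) :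
    ∑ H ∈ (Z₁ ∪ Z₂).powerset, f H =
      ∑ H₁ ∈ Z₁.powerset, ∑ H₂ ∈ Z₂.powerset, f (H₁ ∪ H₂) := by
  rw [← Finset.sum_product']
  refine Finset.sum_nbij' (fun H => (H ∩ Z₁, H ∩ Z₂)) (fun x => x.1 ∪ x.2) ?_ ?_ ?_ ?_ ?_
  · intro H _
    simp
  · rintro ⟨H₁, H₂⟩ hH
    simp only [Finset.mem_product, Finset.mem_powerset] at hH ⊢
    exact Finset.union_subset_union hH.1 hH.2
  · intro H hH
    rw [Finset.mem_powerset] at hH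
    simp only
    rw [← Finset.inter_union_distrib_left, Finset.inter_eq_left.2 hH]
  · rintro ⟨H₁, H₂⟩ hH
    simp only [Finset.mem_product, Finset.mem_powerset] at hH
    have h1 : H₂ ∩ Z₁ = ∅ := Finset.disjoint_iff_inter_eq_empty.1 (h.symm.mono_left hH.2)
    have h2 : H₁ ∩ Z₂ = ∅ := Finset.disjoint_iff_inter_eq_empty.1 (h.mono_left hH.1)
    simp [Finset.union_inter_distrib_right, h1, h2, Finset.inter_eq_left.2 hH.1,
      Finset.inter_eq_left.2 hH.2]
  · intro H hH
    rw [Finset.mem_powerset] at hH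
    rw [← Finset.inter_union_distrib_left, Finset.inter_eq_left.2 hH]

section GraphNorm

variable {n q : ℕ} {pin pout : ℝ}

theorem edgeProb_nonneg (hin : 0 ≤ pin) (hout : 0 ≤ pout) (i j : Fin q) :
    0 ≤ edgeProb pin pout i j := by
  unfold edgeProb; split_ifs <;> assumption

theorem edgeProb_le {c : ℝ} (hin : pin ≤ c) (hout : pout ≤ c) (i j : Fin q) :
    edgeProb pin pout i j ≤ c := by
  unfold edgeProb; split_ifs <;> assumption

theorem edgeProb_comm (i j : Fin q) : edgeProb pin pout i j = edgeProb pin pout j i := by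
  simp only [edgeProb, eq_comm]

theorem edgeWeight_nonneg (hin : 0 ≤ pin) (hout : 0 ≤ pout) (hin1 : pin ≤ 1) (hout1 : pout ≤ 1)
    (Z H : Finset (Fin n × Fin n)) (σ : Fin n → Fin q) : 0 ≤ edgeWeight pin pout Z H σ := by
  refine Finset.prod_nonneg fun e _ => ?_
  split_ifs
  · exact edgeProb_nonneg hin hout _ _
  · exact sub_nonneg.2 (edgeProb_le hin1 hout1 _ _)

theorem sum_edgeWeight (Z : Finset (Fin n × Fin n)) (σ : Fin n → Fin q) :
    ∑ H ∈ Z.powerset, edgeWeight pin pout Z H σ = 1 := by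
  have h := Finset.prod_add (fun e : Fin n × Fin n => edgeProb pin pout (σ e.1) (σ e.2))
    (fun e => 1 - edgeProb pin pout (σ e.1) (σ e.2)) Z
  simp only [add_sub_cancel, Finset.prod_const_one] at h
  rw [h]
  refine Finset.sum_congr rfl fun H hH => ?_
  rw [Finset.mem_powerset] at hH
  rw [edgeWeight, Finset.prod_ite]
  congr 1
  · refine Finset.prod_congr ?_ fun _ _ => rfl
    ext e
    simp only [Finset.mem_filter]
    exact ⟨fun h => h.2, fun h => ⟨hH h, h⟩⟩
  · refine Finset.prod_congr ?_ fun _ _ => rfl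
    ext e
    simp

/-- Data processing: given the labels, the edge weights form a probability law, so passing from
labels to the graph cannot increase total variation. -/
theorem graphNorm_le (hin : 0 ≤ pin) (hout : 0 ≤ pout) (hin1 : pin ≤ 1) (hout1 : pout ≤ 1)
    (Z : Finset (Fin n × Fin n)) (A : (Fin n → Fin q) → ℝ) :
    graphNorm pin pout Z A ≤ labelAvg fun σ => |A σ| := by
  calc graphNorm pin pout Z A
      ≤ ∑ H ∈ Z.powerset, labelAvg fun σ => |A σ| * edgeWeight pin pout Z H σ := by
        refine Finset.sum_le_sum fun H _ => (abs_labelAvg_le _).trans (le_of_eq ?_)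
        congr 1
        funext σ
        rw [abs_mul, abs_of_nonneg (edgeWeight_nonneg hin hout hin1 hout1 _ _ _)]
    _ = _ := by
        rw [← labelAvg_sum]
        congr 1
        funext σ
        rw [← Finset.mul_sum, sum_edgeWeight, mul_one]

theorem graphNorm_add_le (Z : Finset (Fin n × Fin n)) (A B : (Fin n → Fin q) → ℝ) :
    graphNorm pin pout Z (fun σ => A σ + B σ) ≤ graphNorm pin pout Z A + graphNorm pin pout Z B := by
  unfold graphNorm
  rw [← Finset.sum_add_distrib]
  refine Finset.sum_le_sum fun H _ => ?_
  simp only [add_mul]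
  rw [labelAvg_add]
  exact abs_add_le _ _

theorem graphNorm_zero (Z : Finset (Fin n × Fin n)) :
    graphNorm pin pout Z (fun _ : Fin n → Fin q => 0) = 0 := by
  simp [graphNorm, labelAvg]

theorem graphNorm_nonneg (Z : Finset (Fin n × Fin n)) (A : (Fin n → Fin q) → ℝ) :
    0 ≤ graphNorm pin pout Z A :=
  Finset.sum_nonneg fun _ _ => abs_nonneg _

theorem graphNorm_sum_le {ι : Type*} (s : Finset ι) (Z : Finset (Fin n × Fin n))
    (A : ι → (Fin n → Fin q) → ℝ) :
    graphNorm pin pout Z (fun σ => ∑ i ∈ s, A i σ) ≤ ∑ i ∈ s, graphNorm pin pout Z (A i) := by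
  induction s using Finset.induction_on with
  | empty => simp [graphNorm_zero]
  | insert i s hi ih =>
    simp only [Finset.sum_insert hi]
    exact (graphNorm_add_le _ _ _).trans (by gcongr)

theorem graphNorm_const_mul {c : ℝ} (hc : 0 ≤ c) (Z : Finset (Fin n × Fin n))
    (A : (Fin n → Fin q) → ℝ) :
    graphNorm pin pout Z (fun σ => c * A σ) = c * graphNorm pin pout Z A := by
  unfold graphNorm
  rw [Finset.mul_sum]
  refine Finset.sum_congr rfl fun H _ => ?_
  simp only [mul_assoc]
  rw [labelAvg_const_mul, abs_mul, abs_of_nonneg hc]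

/-- Revealing the edges among the pairs `Z₁` first. -/
theorem graphNorm_union {Z₁ Z₂ : Finset (Fin n × Fin n)} (h : Disjoint Z₁ Z₂)
    (A : (Fin n → Fin q) → ℝ) :
    graphNorm pin pout (Z₁ ∪ Z₂) A =
      ∑ H ∈ Z₁.powerset, graphNorm pin pout Z₂ fun σ => A σ * edgeWeight pin pout Z₁ H σ := by
  unfold graphNorm
  rw [Finset.sum_powerset_union h]
  refine Finset.sum_congr rfl fun H₁ h1 => Finset.sum_congr rfl fun H₂ h2 => ?_
  rw [Finset.mem_powerset] at h1 h2
  congr 2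
  funext σ
  rw [mul_assoc]
  congr 1
  unfold edgeWeight
  rw [Finset.prod_union h]
  congr 1
  · refine Finset.prod_congr rfl fun e he => ?_
    have : e ∉ H₂ := fun h' => Finset.disjoint_left.1 h he (h2 h')
    simp [this]
  · refine Finset.prod_congr rfl fun e he => ?_
    have : e ∉ H₁ := fun h' => Finset.disjoint_left.1 h (h1 h') he
    simp [this]

end GraphNorm

/-- The `L¹` distance of two weights is controlled by their Hellinger affinity. -/
theorem sum_abs_sub_le_of_affinity {ι : Type*} (s : Finset ι) (a b : ι → ℝ) {C : ℝ}
    (ha : ∀ i ∈ s, 0 ≤ a i) (hb : ∀ i ∈ s, 0 ≤ b i) (ha1 : ∑ i ∈ s, a i ≤ 1)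
    (hb1 : ∑ i ∈ s, b i ≤ 1) (hC : C ≤ ∑ i ∈ s, √(a i) * √(b i)) :
    ∑ i ∈ s, |a i - b i| ≤ √(8 * (1 - C)) := by
  apply Real.le_sqrt_of_sq_le
  -- Factor |a - b| = |√a - √b| (√a + √b) and apply Cauchy–Schwarz. The two sums of squares are at
  -- most 2 - 2C and 4, whence the 8.
  have h1 : ∑ i ∈ s, |a i - b i| = ∑ i ∈ s, |√(a i) - √(b i)| * (√(a i) + √(b i)) := by
    refine Finset.sum_congr rfl fun i hi => ?_
    rw [← abs_of_nonneg (by positivity : (0 : ℝ) ≤ √(a i) + √(b i)), ← abs_mul]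
    congr 1
    have e1 := Real.sq_sqrt (ha i hi)
    have e2 := Real.sq_sqrt (hb i hi)
    linear_combination -e1 + e2
  have hs1 : ∑ i ∈ s, |√(a i) - √(b i)| ^ 2 ≤ 2 - 2 * C := by
    have : ∑ i ∈ s, |√(a i) - √(b i)| ^ 2 =
        ∑ i ∈ s, a i + ∑ i ∈ s, b i - 2 * ∑ i ∈ s, √(a i) * √(b i) := by
      rw [Finset.mul_sum, ← Finset.sum_add_distrib, ← Finset.sum_sub_distrib]
      refine Finset.sum_congr rfl fun i hi => ?_
      have e1 := Real.sq_sqrt (ha i hi)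
      have e2 := Real.sq_sqrt (hb i hi)
      rw [sq_abs]
      linear_combination e1 + e2
    linarith
  have hs2 : ∑ i ∈ s, (√(a i) + √(b i)) ^ 2 ≤ 4 := by
    calc ∑ i ∈ s, (√(a i) + √(b i)) ^ 2 ≤ ∑ i ∈ s, (2 * a i + 2 * b i) := by
          refine Finset.sum_le_sum fun i hi => ?_
          have e1 := Real.sq_sqrt (ha i hi)
          have e2 := Real.sq_sqrt (hb i hi)
          nlinarith [sq_nonneg (√(a i) - √(b i))]
      _ ≤ 4 := by
          rw [Finset.sum_add_distrib, ← Finset.mul_sum, ← Finset.mul_sum]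
          linarith
  rw [h1]
  refine (Finset.sum_mul_sq_le_sq_mul_sq _ _ _).trans ?_
  have h0 : 0 ≤ ∑ i ∈ s, |√(a i) - √(b i)| ^ 2 := Finset.sum_nonneg fun _ _ => by positivity
  have h0' : 0 ≤ ∑ i ∈ s, (√(a i) + √(b i)) ^ 2 := Finset.sum_nonneg fun _ _ => by positivity
  nlinarith

/-! ### Comparison of the edges at finitely many vertices with a Poisson forest -/

/-- This bound and the next turn products into exponentials at a quadratic cost. With O(n) factors
and p of order 1/n, the total cost is O(1/n). -/
theorem exp_neg_le_one_sub {p : ℝ} (h1 : p ≤ 1 / 2) :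
    Real.exp (-(p + 2 * p ^ 2)) ≤ 1 - p := by
  rw [Real.exp_neg, inv_le_comm₀ (Real.exp_pos _) (by linarith)]
  refine le_trans ?_ (Real.add_one_le_exp _)
  rw [inv_le_iff_one_le_mul₀ (by linarith)]
  nlinarith [mul_self_nonneg p]

theorem exp_sub_sq_le_one_add {p : ℝ} (h0 : 0 ≤ p) : Real.exp (p - p ^ 2) ≤ 1 + p := by
  have : p - p ^ 2 = -(p ^ 2 - p) := by ring
  rw [this, Real.exp_neg, inv_le_comm₀ (Real.exp_pos _) (by linarith)]
  refine le_trans ?_ (Real.add_one_le_exp _)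
  rw [inv_le_iff_one_le_mul₀ (by linarith)]
  nlinarith [pow_nonneg h0 3]

/-- The unordered pair of `x` and `y`, as an increasing pair. -/
def sortedPair {n : ℕ} (x y : Fin n) : Fin n × Fin n := (min x y, max x y)

theorem sortedPair_eq {n : ℕ} {x y x' y' : Fin n} (h : sortedPair x y = sortedPair x' y') :
    (x = x' ∧ y = y') ∨ (x = y' ∧ y = x') := by
  simp only [sortedPair, Prod.mk.injEq] at h
  obtain ⟨h1, h2⟩ := h
  rcases le_total x y with h | h <;> rcases le_total x' y' with h' | h' <;>
    simp only [h, h', min_eq_left, min_eq_right, max_eq_left, max_eq_right] at h1 h2 <;> tauto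

theorem edgeProb_sortedPair {n q : ℕ} {pin pout : ℝ} (σ : Fin n → Fin q) (x y : Fin n) :
    edgeProb pin pout (σ (sortedPair x y).1) (σ (sortedPair x y).2) =
      edgeProb pin pout (σ x) (σ y) := by
  rcases le_total x y with h | h
  · simp [sortedPair, h]
  · simp [sortedPair, h, edgeProb_comm]

section Attach

variable {n q : ℕ} {ι : Type} [Fintype ι]

/-- The ways of attaching every vertex of `T` to at most one element of `ι`. -/
def attachments (ι : Type) [Fintype ι] (T : Finset (Fin n)) : Finset (Fin n → Option ι) :=
  Fintype.piFinset fun y => if y ∈ T then Finset.univ else {none}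

theorem mem_of_mem_attachments {T : Finset (Fin n)} {e : Fin n → Option ι}
    (he : e ∈ attachments ι T) {y : Fin n} (hy : e y ≠ none) : y ∈ T := by
  by_contra h
  have := Fintype.mem_piFinset.1 he y
  simp [h] at this
  exact hy this

/-- The edges of an attachment to the vertices `φ u`. -/
def attachedEdges (φ : ι → Fin n) (e : Fin n → Option ι) : Finset (Fin n × Fin n) :=
  (Finset.univ.filter fun y => e y ≠ none).image fun y => sortedPair ((e y).elim y φ) y

theorem mem_attachedEdges {κ : Type} {φ : κ → Fin n} {e : Fin n → Option κ} {p : Fin n × Fin n} :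
    p ∈ attachedEdges φ e ↔ ∃ y u, e y = some u ∧ sortedPair (φ u) y = p := by
  simp only [attachedEdges, Finset.mem_image, Finset.mem_filter, Finset.mem_univ, true_and]
  constructor
  · rintro ⟨y, hy, rfl⟩
    obtain ⟨u, hu⟩ := Option.ne_none_iff_exists'.1 hy
    exact ⟨y, u, hu, by simp [hu]⟩
  · rintro ⟨y, u, hu, rfl⟩
    exact ⟨y, by simp [hu], by simp [hu]⟩

/-- An attached edge has one end in the image of `φ` and the other in `T`, which are disjoint; so
the edge tells which end is the parent. -/
theorem attachedEdges_injOn {φ : ι → Fin n} (hφ : Function.Injective φ) {T : Finset (Fin n)}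
    (hT : ∀ u, φ u ∉ T) :
    Set.InjOn (attachedEdges φ) (attachments ι T : Set (Fin n → Option ι)) := by
  have key : ∀ e ∈ attachments ι T, ∀ e' ∈ attachments ι T, attachedEdges φ e = attachedEdges φ e' →
      ∀ y u, e y = some u → e' y = some u := by
    intro e he e' he' h y u hu
    have h1 : sortedPair (φ u) y ∈ attachedEdges φ e' := h ▸ mem_attachedEdges.2 ⟨y, u, hu, rfl⟩
    obtain ⟨y', u', hu', h2⟩ := mem_attachedEdges.1 h1
    rcases sortedPair_eq h2 with ⟨h3, rfl⟩ | ⟨h3, -⟩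
    · rw [← hφ h3, hu']
    · exact absurd (h3 ▸ mem_of_mem_attachments he (y := y) (by simp [hu])) (hT u')
  intro e he e' he' h
  funext y
  ext u
  exact ⟨key e he e' he' h y u, key e' he' e he h.symm y u⟩

/-- The product of the connection probabilities along an attachment. -/
def attachWeight (pin pout : ℝ) (φ : ι → Fin n) (e : Fin n → Option ι) (σ : Fin n → Fin q) : ℝ :=
  ∏ y, (e y).elim 1 fun u => edgeProb pin pout (σ (φ u)) (σ y)

theorem attachWeight_nonneg {κ : Type} {pin pout : ℝ} (hin : 0 ≤ pin) (hout : 0 ≤ pout) (φ : κ → Fin n)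
    (e : Fin n → Option κ) (σ : Fin n → Fin q) : 0 ≤ attachWeight pin pout φ e σ := by
  refine Finset.prod_nonneg fun y _ => ?_
  cases e y
  · simp
  · exact edgeProb_nonneg hin hout _ _

theorem prod_attachedEdges {pin pout : ℝ} {φ : ι → Fin n} {T : Finset (Fin n)}
    (hT : ∀ u, φ u ∉ T) {e : Fin n → Option ι} (he : e ∈ attachments ι T) (σ : Fin n → Fin q) :
    ∏ p ∈ attachedEdges φ e, edgeProb pin pout (σ p.1) (σ p.2) = attachWeight pin pout φ e σ := by
  rw [attachedEdges, Finset.prod_image, attachWeight, Finset.prod_filter]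
  · refine Finset.prod_congr rfl fun y _ => ?_
    rw [edgeProb_sortedPair]
    cases h : e y <;> simp
  · intro y hy y' hy' h
    simp only [Finset.coe_filter, Finset.mem_univ, true_and, Set.mem_ofPred_eq] at hy hy'
    obtain ⟨u, hu⟩ := Option.ne_none_iff_exists'.1 hy
    obtain ⟨u', hu'⟩ := Option.ne_none_iff_exists'.1 hy'
    simp only [hu, hu', Option.elim_some] at h
    rcases sortedPair_eq h with ⟨-, h⟩ | ⟨h, -⟩
    · exact h
    · exact absurd (h ▸ mem_of_mem_attachments he hy') (hT u)

/-- The vertices of `T` choose their parents freely, so the sum over attachments factorises. -/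
theorem sum_attachWeight {pin pout : ℝ} (φ : ι → Fin n) (T : Finset (Fin n)) (σ : Fin n → Fin q) :
    ∑ e ∈ attachments ι T, attachWeight pin pout φ e σ =
      ∏ y ∈ T, (1 + ∑ u, edgeProb pin pout (σ (φ u)) (σ y)) := by
  have h := (Finset.prod_univ_sum (fun y : Fin n => if y ∈ T then Finset.univ else {none})
    fun y (o : Option ι) => o.elim 1 fun u => edgeProb pin pout (σ (φ u)) (σ y)).symm
  unfold attachments attachWeight
  rw [h, ← Finset.prod_subset (Finset.subset_univ T)]
  · refine Finset.prod_congr rfl fun y hy => ?_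
    simp [hy, Fintype.sum_option]
  · intro y _ hy
    simp [hy]

/-- Letting the absent-edge factors run over all of `Z`, including the present edges, only lowers
the weight. It leaves a factor independent of the attachment, so the sum over attachments can be
carried out. -/
theorem edgeWeight_attachedEdges_ge {pin pout : ℝ} (hin : 0 ≤ pin) (hout : 0 ≤ pout)
    (hin1 : pin ≤ 1) (hout1 : pout ≤ 1) {φ : ι → Fin n} {T : Finset (Fin n)}
    (hT : ∀ u, φ u ∉ T) {e : Fin n → Option ι} (he : e ∈ attachments ι T)
    {Z : Finset (Fin n × Fin n)} (hZ : attachedEdges φ e ⊆ Z) (σ : Fin n → Fin q) :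
    attachWeight pin pout φ e σ * ∏ p ∈ Z, (1 - edgeProb pin pout (σ p.1) (σ p.2)) ≤
      edgeWeight pin pout Z (attachedEdges φ e) σ := by
  rw [← prod_attachedEdges hT he, ← Finset.inter_eq_right.2 hZ, ← Finset.filter_mem_eq_inter,
    Finset.prod_filter, ← Finset.prod_mul_distrib, Finset.filter_mem_eq_inter,
    Finset.inter_eq_right.2 hZ, edgeWeight]
  refine Finset.prod_le_prod (fun p _ => ?_) fun p _ => ?_
  · have h0 := edgeProb_nonneg hin hout (σ p.1) (σ p.2)
    have h1 := edgeProb_le hin1 hout1 (σ p.1) (σ p.2)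
    split_ifs
    · exact mul_nonneg h0 (by linarith)
    · linarith
  · have h0 := edgeProb_nonneg hin hout (σ p.1) (σ p.2)
    have h1 := edgeProb_le hin1 hout1 (σ p.1) (σ p.2)
    split_ifs
    · nlinarith
    · linarith

end Attach

theorem avg_edgeProb {q : ℕ} (pin pout : ℝ) (i : Fin q) :
    (1 / (q : ℝ)) * ∑ c, edgeProb pin pout i c = (pin + ((q : ℝ) - 1) * pout) / q := by
  have : ∑ c, edgeProb pin pout i c = pin + ((q : ℝ) - 1) * pout := by
    have h : ∀ c, edgeProb pin pout i c = pout + if i = c then pin - pout else 0 := by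
      intro c; unfold edgeProb; split_ifs <;> ring
    simp only [h, Finset.sum_add_distrib, Finset.sum_ite_eq, Finset.mem_univ, if_true,
      Finset.sum_const, Finset.card_univ, Fintype.card_fin, nsmul_eq_mul]
    ring
  rw [this]
  ring

theorem labelAvg_edgeProb {n q : ℕ} (hq : q ≠ 0) (pin pout : ℝ) {x y : Fin n} (hxy : x ≠ y) :
    labelAvg (fun σ : Fin n → Fin q => edgeProb pin pout (σ x) (σ y)) =
      (pin + ((q : ℝ) - 1) * pout) / q := by
  rw [labelAvg_update hq _ y]
  simp only [Function.update_self, Function.update_of_ne hxy, avg_edgeProb]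
  exact labelAvg_const hq _

/-! ### Hellinger comparison of the revealed edges with the ideal forest. -/

section Compare

variable {n q : ℕ} {ι : Type} [Fintype ι] {pin pout c d : ℝ}

/-- The mass of the ideal forest law is at most one. -/
theorem labelAvg_sum_attachWeight_le (hq : q ≠ 0) (hn : n ≠ 0)
    (hd : (pin + ((q : ℝ) - 1) * pout) / q = d / n) (hd0 : 0 ≤ d) (φ : ι → Fin n)
    {T : Finset (Fin n)} (hT : ∀ u, φ u ∉ T) :
    labelAvg (fun σ : Fin n → Fin q => Real.exp (-(d * Fintype.card ι)) *
      ∑ e ∈ attachments ι T, attachWeight pin pout φ e σ) ≤ 1 := by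
  have hn' : (0 : ℝ) < n := by positivity
  have hq' : (q : ℝ) ≠ 0 := by exact_mod_cast hq
  rw [labelAvg_const_mul]
  simp only [sum_attachWeight]
  -- Whatever the labels of the vertices `φ u`, the factor of `y` averages to 1 + kd/n with k = |ι|;
  -- the product of these is at most e^{dk}.
  rw [labelAvg_prod hq (fun y σ => 1 + ∑ u, edgeProb pin pout (σ (φ u)) (σ y))
    (fun _ => 1 + Fintype.card ι * (d / n)) T]
  · have h1 : ∏ y ∈ T, (1 + Fintype.card ι * (d / n)) ≤ Real.exp (d * Fintype.card ι) := by
      calc ∏ y ∈ T, (1 + Fintype.card ι * (d / n))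
          ≤ ∏ y ∈ T, Real.exp (Fintype.card ι * (d / n)) := by
            refine Finset.prod_le_prod (fun _ _ => by positivity) fun _ _ => ?_
            rw [add_comm]
            exact Real.add_one_le_exp _
        _ = Real.exp (T.card * (Fintype.card ι * (d / n))) := by
            rw [Finset.prod_const, ← Real.exp_nat_mul]
        _ ≤ Real.exp (n * (Fintype.card ι * (d / n))) := by
            have : T.card ≤ n := by simpa using Finset.card_le_univ T
            gcongr
        _ = _ := by
            congr 1
            field_simp
    calc _ ≤ Real.exp (-(d * Fintype.card ι)) * Real.exp (d * Fintype.card ι) := by gcongr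
      _ = 1 := by rw [← Real.exp_add]; simp
  · intro y hy y' hy' hne σ c
    have h2 : ∀ u, φ u ≠ y' := fun u h => hT u (h ▸ hy')
    simp [Function.update_of_ne hne.symm, Function.update_of_ne (h2 _)]
  · intro y hy σ
    have h2 : ∀ u, φ u ≠ y := fun u h => hT u (h ▸ hy)
    simp only [Function.update_self, Function.update_of_ne (h2 _), Finset.sum_add_distrib, mul_add]
    have e : (1 / (q : ℝ)) * ∑ c, ∑ u, edgeProb pin pout (σ (φ u)) c =
        ∑ u, (1 / (q : ℝ)) * ∑ c, edgeProb pin pout (σ (φ u)) c := by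
      rw [Finset.sum_comm, Finset.mul_sum]
    rw [e]
    simp only [avg_edgeProb, hd]
    simp [hq']

/-- The integrand is a lower bound for the affinity once the attachments are summed. By Jensen it
suffices to average its logarithm: the normalisation gives -dk/2, the absent edges at least -dk/2
and the attachments at least dk(1 - L/n), so the first-order terms cancel. -/
theorem affinity_ge (hq : q ≠ 0) (hn : n ≠ 0) (hin : 0 ≤ pin) (hout : 0 ≤ pout)
    (hinc : pin ≤ c / n) (houtc : pout ≤ c / n) (hc : c / n ≤ 1 / 2)
    (hd : (pin + ((q : ℝ) - 1) * pout) / q = d / n) (hd0 : 0 ≤ d)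
    (φ : ι → Fin n) {T : Finset (Fin n)} (hT : ∀ u, φ u ∉ T) {L : ℝ}
    (hTn : n ≤ T.card + L) {Z : Finset (Fin n × Fin n)} (hZ : ∀ e ∈ Z, e.1 ≠ e.2)
    (hZc : (Z.card : ℝ) ≤ Fintype.card ι * n) :
    1 - (Fintype.card ι * c ^ 2 + (Fintype.card ι * c) ^ 2 + Fintype.card ι * d * L) / n ≤
      labelAvg fun σ : Fin n → Fin q => Real.exp (-(d * Fintype.card ι) / 2) *
        √(∏ p ∈ Z, (1 - edgeProb pin pout (σ p.1) (σ p.2))) *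
        ∏ y ∈ T, (1 + ∑ u, edgeProb pin pout (σ (φ u)) (σ y)) := by
  set k : ℝ := ((Fintype.card ι : ℕ) : ℝ) with hk
  have hk0 : 0 ≤ k := by positivity
  have hn' : (0 : ℝ) < n := by positivity
  have hc0 : 0 ≤ c / n := hin.trans hinc
  set ε := c / n with hε
  have p0 := fun i j : Fin q => edgeProb_nonneg (pin := pin) (pout := pout) hin hout i j
  have p1 := fun i j : Fin q => edgeProb_le (pin := pin) (pout := pout) hinc houtc i j
  -- The deterministic terms k n ε² and n (kε)² pay for replacing 1 - p and 1 + p by exponentials;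
  -- the rest is linear in the connection probabilities.
  let X : (Fin n → Fin q) → ℝ := fun σ => (-(d * k) / 2 - k * n * ε ^ 2 - n * (k * ε) ^ 2) +
    ((-1 / 2) * ∑ p ∈ Z, edgeProb pin pout (σ p.1) (σ p.2) +
      ∑ y ∈ T, ∑ u, edgeProb pin pout (σ (φ u)) (σ y))
  have hX : ∀ σ : Fin n → Fin q, Real.exp (X σ) ≤ Real.exp (-(d * k) / 2) *
        √(∏ p ∈ Z, (1 - edgeProb pin pout (σ p.1) (σ p.2))) *
        ∏ y ∈ T, (1 + ∑ u, edgeProb pin pout (σ (φ u)) (σ y)) := by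
    intro σ
    have e1 : Real.exp ((-1 / 2) * ∑ p ∈ Z, edgeProb pin pout (σ p.1) (σ p.2) - k * n * ε ^ 2) ≤
        √(∏ p ∈ Z, (1 - edgeProb pin pout (σ p.1) (σ p.2))) := by
      apply Real.le_sqrt_of_sq_le
      rw [← Real.exp_nat_mul]
      calc _ ≤ Real.exp (∑ p ∈ Z, -(edgeProb pin pout (σ p.1) (σ p.2) +
              2 * edgeProb pin pout (σ p.1) (σ p.2) ^ 2)) := by
            apply Real.exp_le_exp.2
            rw [Finset.sum_neg_distrib, Finset.sum_add_distrib, ← Finset.mul_sum]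
            have : ∑ p ∈ Z, edgeProb pin pout (σ p.1) (σ p.2) ^ 2 ≤ k * n * ε ^ 2 := by
              calc _ ≤ ∑ p ∈ Z, ε ^ 2 := by
                    refine Finset.sum_le_sum fun p _ => ?_
                    have := p0 (σ p.1) (σ p.2)
                    have := p1 (σ p.1) (σ p.2)
                    gcongr
                _ ≤ _ := by
                    rw [Finset.sum_const, nsmul_eq_mul]
                    gcongr
            push_cast
            linarith
        _ ≤ _ := by
            rw [Real.exp_sum]
            refine Finset.prod_le_prod (fun _ _ => (Real.exp_pos _).le) fun p _ => ?_
            exact exp_neg_le_one_sub ((p1 _ _).trans hc)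
    have e2 : Real.exp (∑ y ∈ T, ∑ u, edgeProb pin pout (σ (φ u)) (σ y) - n * (k * ε) ^ 2) ≤
        ∏ y ∈ T, (1 + ∑ u, edgeProb pin pout (σ (φ u)) (σ y)) := by
      have hP0 : ∀ y, 0 ≤ ∑ u, edgeProb pin pout (σ (φ u)) (σ y) :=
        fun y => Finset.sum_nonneg fun u _ => p0 _ _
      have hP1 : ∀ y, ∑ u, edgeProb pin pout (σ (φ u)) (σ y) ≤ k * ε := by
        intro y
        calc _ ≤ ∑ u : ι, ε := Finset.sum_le_sum fun u _ => p1 _ _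
          _ = _ := by simp [hk]
      calc _ ≤ Real.exp (∑ y ∈ T, (∑ u, edgeProb pin pout (σ (φ u)) (σ y) -
              (∑ u, edgeProb pin pout (σ (φ u)) (σ y)) ^ 2)) := by
            apply Real.exp_le_exp.2
            rw [Finset.sum_sub_distrib]
            have : ∑ y ∈ T, (∑ u, edgeProb pin pout (σ (φ u)) (σ y)) ^ 2 ≤ n * (k * ε) ^ 2 := by
              calc _ ≤ ∑ y ∈ T, (k * ε) ^ 2 := by
                    refine Finset.sum_le_sum fun y _ => ?_
                    exact pow_le_pow_left₀ (hP0 y) (hP1 y) 2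
                _ ≤ _ := by
                    rw [Finset.sum_const, nsmul_eq_mul]
                    have : T.card ≤ n := by simpa using Finset.card_le_univ T
                    gcongr
            linarith
        _ ≤ _ := by
            rw [Real.exp_sum]
            exact Finset.prod_le_prod (fun _ _ => (Real.exp_pos _).le) fun y _ =>
              exp_sub_sq_le_one_add (hP0 y)
    calc Real.exp (X σ) = Real.exp (-(d * k) / 2) *
          Real.exp ((-1 / 2) * ∑ p ∈ Z, edgeProb pin pout (σ p.1) (σ p.2) - k * n * ε ^ 2) *
          Real.exp (∑ y ∈ T, ∑ u, edgeProb pin pout (σ (φ u)) (σ y) - n * (k * ε) ^ 2) := by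
          rw [← Real.exp_add, ← Real.exp_add]
          congr 1
          simp only [X]
          ring
      _ ≤ _ := by gcongr
  refine le_trans ?_ ((exp_labelAvg_le hq X).trans (labelAvg_mono hX))
  refine le_trans ?_ (Real.add_one_le_exp _)
  have hXavg : labelAvg X = (-(d * k) / 2 - k * n * ε ^ 2 - n * (k * ε) ^ 2) +
      ((-1 / 2) * (Z.card * (d / n)) + T.card * (k * (d / n))) := by
    simp only [X]
    rw [labelAvg_add, labelAvg_const hq, labelAvg_add, labelAvg_const_mul, labelAvg_sum,
      labelAvg_sum]
    congr 2
    · rw [Finset.sum_congr rfl fun p hp => labelAvg_edgeProb hq pin pout (hZ p hp), hd]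
      simp
    · rw [← nsmul_eq_mul, ← Finset.sum_const]
      refine Finset.sum_congr rfl fun y hy => ?_
      rw [labelAvg_sum]
      rw [Finset.sum_congr rfl fun u _ => labelAvg_edgeProb hq pin pout
        (x := φ u) (y := y) (fun h => hT u (h ▸ hy)), hd]
      simp [hk]
  rw [hXavg]
  have f1 : (Z.card : ℝ) * (d / n) ≤ k * d := by
    calc _ ≤ (k * n) * (d / n) := by gcongr
      _ = _ := by field_simp
  have f2 : k * d - k * d * L / n ≤ T.card * (k * (d / n)) := by
    have : (n : ℝ) - L ≤ T.card := by linarith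
    calc k * d - k * d * L / n = (n - L) * (k * (d / n)) := by field_simp
      _ ≤ _ := by gcongr
  have f3 : (k * c ^ 2 + (k * c) ^ 2 + k * d * L) / n =
      k * n * ε ^ 2 + n * (k * ε) ^ 2 + k * d * L / n := by
    rw [hε]
    field_simp
  rw [f3]
  linarith

/-- The law of the forest attached to the vertices `φ u`, as a weight on sets of edges. -/
def forestWeight (pin pout d : ℝ) (φ : ι → Fin n) (T : Finset (Fin n))
    (H : Finset (Fin n × Fin n)) (σ : Fin n → Fin q) : ℝ :=
  ∑ e ∈ attachments ι T with attachedEdges φ e = H,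
    Real.exp (-(d * Fintype.card ι)) * attachWeight pin pout φ e σ

/-- Both joint laws of labels and edges have mass at most one, so the affinity controls their
distance. Only the edge sets of attachments are kept in the affinity: there the geometric mean of
the two weights is at least `attachWeight` times a factor common to all attachments. Keeping the
labels in the comparison allows it to be multiplied by any bounded signed density. -/
theorem labelAvg_sum_abs_sub_le (hq : q ≠ 0) (hn : n ≠ 0) (hin : 0 ≤ pin) (hout : 0 ≤ pout)
    (hinc : pin ≤ c / n) (houtc : pout ≤ c / n) (hc : c / n ≤ 1 / 2)
    (hd : (pin + ((q : ℝ) - 1) * pout) / q = d / n) (hd0 : 0 ≤ d)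
    (φ : ι → Fin n) (hφ : Function.Injective φ) {T : Finset (Fin n)} (hT : ∀ u, φ u ∉ T) {L : ℝ}
    (hTn : n ≤ T.card + L) {Z : Finset (Fin n × Fin n)} (hZ : ∀ e ∈ Z, e.1 ≠ e.2)
    (hZc : (Z.card : ℝ) ≤ Fintype.card ι * n)
    (hTZ : ∀ e ∈ attachments ι T, attachedEdges φ e ⊆ Z) :
    labelAvg (fun σ : Fin n → Fin q => ∑ H ∈ Z.powerset,
      |edgeWeight pin pout Z H σ - forestWeight pin pout d φ T H σ|) ≤
    √(8 * ((Fintype.card ι * c ^ 2 + (Fintype.card ι * c) ^ 2 + Fintype.card ι * d * L) / n)) := by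
  have hin1 : pin ≤ 1 := by linarith
  have hout1 : pout ≤ 1 := by linarith
  set k : ℝ := ((Fintype.card ι : ℕ) : ℝ) with hk
  set w : ℝ := (1 / (q : ℝ)) ^ n with hw
  have hw0 : 0 ≤ w := by positivity
  have hf0 : ∀ H (σ : Fin n → Fin q), 0 ≤ forestWeight pin pout d φ T H σ := fun H σ =>
    Finset.sum_nonneg fun e _ => mul_nonneg (Real.exp_pos _).le (attachWeight_nonneg hin hout _ _ _)
  have hfsum : ∀ σ : Fin n → Fin q, ∑ H ∈ Z.powerset, forestWeight pin pout d φ T H σ =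
      Real.exp (-(d * k)) * ∑ e ∈ attachments ι T, attachWeight pin pout φ e σ := by
    intro σ
    unfold forestWeight
    rw [Finset.sum_fiberwise_of_maps_to fun e he => Finset.mem_powerset.2 (hTZ e he),
      Finset.mul_sum]
  have hfe : ∀ e ∈ attachments ι T, ∀ σ : Fin n → Fin q,
      forestWeight pin pout d φ T (attachedEdges φ e) σ =
        Real.exp (-(d * k)) * attachWeight pin pout φ e σ := by
    intro e he σ
    unfold forestWeight
    rw [Finset.sum_eq_single e]
    · intro e' he' hne
      rw [Finset.mem_filter] at he'
      exact absurd (attachedEdges_injOn hφ hT he'.1 he he'.2) hne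
    · intro h
      simp [he] at h
  have key := sum_abs_sub_le_of_affinity
    ((Finset.univ : Finset (Fin n → Fin q)) ×ˢ Z.powerset)
    (fun x => w * edgeWeight pin pout Z x.2 x.1)
    (fun x => w * forestWeight pin pout d φ T x.2 x.1)
    (C := 1 - (k * c ^ 2 + (k * c) ^ 2 + k * d * L) / n)
    (fun x _ => mul_nonneg hw0 (edgeWeight_nonneg hin hout hin1 hout1 _ _ _))
    (fun x _ => mul_nonneg hw0 (hf0 _ _)) ?_ ?_ ?_
  · refine le_trans (le_of_eq ?_) (key.trans (le_of_eq ?_))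
    · rw [Finset.sum_product]
      simp only [labelAvg, ← mul_sub, abs_mul, abs_of_nonneg hw0, ← Finset.mul_sum]
      rw [← hw]
    · congr 2
      ring
  · rw [Finset.sum_product]
    simp only [← Finset.mul_sum, sum_edgeWeight]
    exact (labelAvg_const (n := n) hq 1).le
  · rw [Finset.sum_product]
    simp only [← Finset.mul_sum, hfsum]
    have := labelAvg_sum_attachWeight_le hq hn hd hd0 φ hT
    unfold labelAvg at this
    rw [← Finset.mul_sum] at this
    exact this
  · refine (affinity_ge hq hn hin hout hinc houtc hc hd hd0 φ hT hTn hZ hZc).trans ?_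
    rw [Finset.sum_product]
    simp only [Real.sqrt_mul hw0]
    unfold labelAvg
    rw [Finset.mul_sum]
    refine Finset.sum_le_sum fun σ _ => ?_
    have hsq : ∀ x y : ℝ, √w * x * (√w * y) = w * (x * y) := by
      intro x y
      have := Real.mul_self_sqrt hw0
      linear_combination x * y * this
    simp only [hsq, ← Finset.mul_sum]
    refine mul_le_mul_of_nonneg_left ?_ hw0
    calc Real.exp (-(d * k) / 2) * √(∏ p ∈ Z, (1 - edgeProb pin pout (σ p.1) (σ p.2))) *
          ∏ y ∈ T, (1 + ∑ u, edgeProb pin pout (σ (φ u)) (σ y))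
        = ∑ e ∈ attachments ι T, Real.exp (-(d * k) / 2) *
          √(∏ p ∈ Z, (1 - edgeProb pin pout (σ p.1) (σ p.2))) * attachWeight pin pout φ e σ := by
          rw [← sum_attachWeight, Finset.mul_sum]
      _ ≤ ∑ e ∈ attachments ι T, √(edgeWeight pin pout Z (attachedEdges φ e) σ) *
          √(forestWeight pin pout d φ T (attachedEdges φ e) σ) := by
          refine Finset.sum_le_sum fun e he => ?_
          have hb := attachWeight_nonneg hin hout φ e σ
          have hQ : 0 ≤ ∏ p ∈ Z, (1 - edgeProb pin pout (σ p.1) (σ p.2)) :=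
            Finset.prod_nonneg fun p _ => by linarith [edgeProb_le hin1 hout1 (σ p.1) (σ p.2)]
          rw [hfe e he, Real.sqrt_mul (Real.exp_pos _).le]
          have e3 : √(Real.exp (-(d * k))) = Real.exp (-(d * k) / 2) := by
            rw [Real.exp_half]
          have e4 := Real.sqrt_le_sqrt
            (edgeWeight_attachedEdges_ge hin hout hin1 hout1 hT he (hTZ e he) σ)
          rw [Real.sqrt_mul hb] at e4
          calc _ = (√(attachWeight pin pout φ e σ) *
              √(∏ p ∈ Z, (1 - edgeProb pin pout (σ p.1) (σ p.2)))) *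
              (Real.exp (-(d * k) / 2) * √(attachWeight pin pout φ e σ)) := by
                have := Real.mul_self_sqrt hb
                linear_combination -(Real.exp (-(d * k) / 2) *
                  √(∏ p ∈ Z, (1 - edgeProb pin pout (σ p.1) (σ p.2)))) * this
            _ ≤ _ := by
                rw [e3]
                gcongr
      _ = ∑ H ∈ (attachments ι T).image (attachedEdges φ), √(edgeWeight pin pout Z H σ) *
          √(forestWeight pin pout d φ T H σ) := by
          rw [Finset.sum_image (attachedEdges_injOn hφ hT)]
      _ ≤ _ := by
          refine Finset.sum_le_sum_of_subset_of_nonneg ?_ fun _ _ _ => by positivity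
          intro H hH
          obtain ⟨e, he, rfl⟩ := Finset.mem_image.1 hH
          exact Finset.mem_powerset.2 (hTZ e he)

end Compare

/-! ### Exploration of one level of the forest -/

/-- The children of the words in `S`. -/
def nextLevel (S : Finset (List ℕ)) (N : List ℕ → ℕ) : Finset (List ℕ) :=
  S.biUnion fun u => (Finset.range (N u)).image fun k => k :: u

theorem mem_nextLevel {S : Finset (List ℕ)} {N : List ℕ → ℕ} {w : List ℕ} :
    w ∈ nextLevel S N ↔ ∃ u ∈ S, ∃ k < N u, k :: u = w := by
  simp [nextLevel]

theorem tail_mem_of_mem_nextLevel {S : Finset (List ℕ)} {N : List ℕ → ℕ} {w : List ℕ}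
    (hw : w ∈ nextLevel S N) : w.tail ∈ S := by
  obtain ⟨u, hu, k, -, rfl⟩ := mem_nextLevel.1 hw
  simpa using hu

theorem nextLevel_congr {S : Finset (List ℕ)} {N N' : List ℕ → ℕ} (h : ∀ u ∈ S, N u = N' u) :
    nextLevel S N = nextLevel S N' :=
  Finset.biUnion_congr rfl fun u hu => by rw [h u hu]

theorem card_nextLevel (S : Finset (List ℕ)) (N : List ℕ → ℕ) :
    (nextLevel S N).card = ∑ u ∈ S, N u := by
  unfold nextLevel
  rw [Finset.card_biUnion]
  · refine Finset.sum_congr rfl fun u _ => ?_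
    rw [Finset.card_image_of_injective _ fun a b h => (List.cons.inj h).1, Finset.card_range]
  · intro u _ u' _ hne
    rw [Function.onFun, Finset.disjoint_left]
    intro w hw hw'
    obtain ⟨k, -, rfl⟩ := Finset.mem_image.1 hw
    obtain ⟨k', -, h⟩ := Finset.mem_image.1 hw'
    exact hne (List.cons.inj h).2.symm

/-- Broadcasting a signed weight on the labels of `S` to the labels of the children `S'`. -/
def pushLabels (q : ℕ) (lam : ℝ) (S S' : Finset (List ℕ)) (α : (S → Fin q) → ℝ)
    (τ' : S' → Fin q) : ℝ :=
  ∑ τ : S → Fin q, α τ * ∏ w : S',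
    -- The default is never used when `S'` is the next level of `S`. Being uniform, it keeps each
    -- row of total mass one for arbitrary `S` and `S'`.
    if h : w.1.tail ∈ S then channel q lam (τ ⟨w.1.tail, h⟩) (τ' w) else 1 / (q : ℝ)

/-- A level of the explored forest, a signed weight on the labels of its vertices, and a number
of vertices removed so far. -/
structure ForestState (q : ℕ) where
  level : Finset (List ℕ)
  weight : (level → Fin q) → ℝ
  removed : ℕ

/-- Exploration of the next level. -/
def ForestState.step {q : ℕ} (lam : ℝ) (s : ForestState q) (N : List ℕ → ℕ) : ForestState q where
  level := nextLevel s.level N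
  weight := pushLabels q lam s.level (nextLevel s.level N) s.weight
  removed := s.removed + s.level.card

theorem ForestState.step_congr {q : ℕ} (lam : ℝ) (s : ForestState q) {N N' : List ℕ → ℕ}
    (h : ∀ u ∈ s.level, N u = N' u) : s.step lam N = s.step lam N' := by
  unfold ForestState.step
  rw [nextLevel_congr h]

/-- Largest total variation norm, over the ways to embed the level of `s` in the vertices of a
block model with at most `s.removed` vertices removed, of the signed law of the graph with the
labels of the level weighted by `s.weight`. The vertex `v` is any other vertex. -/
def forestNorm (n : ℕ) {q : ℕ} (pin pout : ℝ) (h : Fin q → ℝ) (s : ForestState q) : ENNReal :=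
  ⨆ (U : Finset (Fin n)) (v : Fin n) (φ : List ℕ → Fin n) (_ : Set.InjOn φ s.level)
    (_ : ∀ u ∈ s.level, φ u ∈ U ∧ φ u ≠ v) (_ : n ≤ U.card + s.removed),
    ENNReal.ofReal (graphNorm pin pout (pairsIn U) fun σ =>
      (q : ℝ) ^ s.level.card * s.weight (fun u => σ (φ u)) * h (σ v))

theorem le_forestNorm {n q : ℕ} {pin pout : ℝ} {h : Fin q → ℝ} {s : ForestState q}
    {U : Finset (Fin n)} {v : Fin n} {φ : List ℕ → Fin n} (hφ : Set.InjOn φ s.level)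
    (hU : ∀ u ∈ s.level, φ u ∈ U ∧ φ u ≠ v) (hn : n ≤ U.card + s.removed) :
    ENNReal.ofReal (graphNorm pin pout (pairsIn U) fun σ =>
      (q : ℝ) ^ s.level.card * s.weight (fun u => σ (φ u)) * h (σ v)) ≤
      forestNorm n pin pout h s :=
  le_iSup_of_le U <| le_iSup_of_le v <| le_iSup_of_le φ <| le_iSup_of_le hφ <|
    le_iSup_of_le hU <| le_iSup_of_le hn le_rfl

/-- Labels at distinct vertices are independent and uniform, so the power of q turns a weight on
them into a density. -/
theorem labelAvg_comp_injective {n q : ℕ} (hq : q ≠ 0) {ι : Type} [Fintype ι] [DecidableEq ι]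
    {φ : ι → Fin n} (hφ : Function.Injective φ) (f : (ι → Fin q) → ℝ) :
    labelAvg (fun σ => (q : ℝ) ^ Fintype.card ι * f fun u => σ (φ u)) = ∑ τ, f τ := by
  have hq' : (q : ℝ) ≠ 0 := by exact_mod_cast hq
  rw [labelAvg_extend hq φ hφ]
  simp only [hφ.extend_apply, ← Finset.mul_sum]
  rw [labelAvg_const hq, ← mul_assoc, ← mul_pow]
  simp [hq']

theorem forestNorm_le {n q : ℕ} (hq : q ≠ 0) {pin pout : ℝ} (hin : 0 ≤ pin) (hout : 0 ≤ pout)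
    (hin1 : pin ≤ 1) (hout1 : pout ≤ 1) {h : Fin q → ℝ} (hh : ∀ i, |h i| ≤ 1)
    (s : ForestState q) :
    forestNorm n pin pout h s ≤ ENNReal.ofReal (∑ τ, |s.weight τ|) := by
  refine iSup_le fun U => iSup_le fun v => iSup_le fun φ => iSup_le fun hφ => iSup_le fun _ =>
    iSup_le fun _ => ENNReal.ofReal_le_ofReal ?_
  refine (graphNorm_le hin hout hin1 hout1 _ _).trans ?_
  have hφ' : Function.Injective fun u : s.level => φ u := fun u u' hu =>
    Subtype.ext (hφ u.2 u'.2 hu)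
  rw [← labelAvg_comp_injective hq hφ' fun τ => |s.weight τ|, Fintype.card_coe]
  refine labelAvg_mono fun σ => ?_
  rw [abs_mul, abs_mul, abs_of_nonneg (by positivity : (0 : ℝ) ≤ (q : ℝ) ^ s.level.card)]
  exact mul_le_of_le_one_right (by positivity) (hh _)

theorem sum_channel {q : ℕ} (hq : q ≠ 0) (lam : ℝ) (i : Fin q) : ∑ j, channel q lam i j = 1 := by
  have hq' : (q : ℝ) ≠ 0 := by exact_mod_cast hq
  have h : ∀ j, channel q lam i j = (1 - lam) / q + if i = j then lam else 0 := by
    intro j; unfold channel; split_ifs <;> ring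
  simp only [h, Finset.sum_add_distrib, Finset.sum_ite_eq, Finset.mem_univ, if_true,
    Finset.sum_const, Finset.card_univ, Fintype.card_fin, nsmul_eq_mul]
  field_simp
  ring

/-- A Markov kernel contracts the L¹ norm of signed weights. -/
theorem sum_abs_pushLabels_le {q : ℕ} (hq : q ≠ 0) {lam : ℝ}
    (hch : ∀ i j, 0 ≤ channel q lam i j) (S S' : Finset (List ℕ)) (α : (S → Fin q) → ℝ) :
    ∑ τ', |pushLabels q lam S S' α τ'| ≤ ∑ τ, |α τ| := by
  have hq' : (q : ℝ) ≠ 0 := by exact_mod_cast hq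
  have h0 : ∀ (τ : S → Fin q) (w : S') (j : Fin q), 0 ≤
      if h : w.1.tail ∈ S then channel q lam (τ ⟨w.1.tail, h⟩) j else 1 / (q : ℝ) := by
    intro τ w j
    split_ifs
    · exact hch _ _
    · positivity
  calc ∑ τ', |pushLabels q lam S S' α τ'|
      ≤ ∑ τ' : S' → Fin q, ∑ τ : S → Fin q, |α τ| * ∏ w : S',
        if h : w.1.tail ∈ S then channel q lam (τ ⟨w.1.tail, h⟩) (τ' w) else 1 / (q : ℝ) := by
        refine Finset.sum_le_sum fun τ' _ => (Finset.abs_sum_le_sum_abs _ _).trans (le_of_eq ?_)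
        refine Finset.sum_congr rfl fun τ _ => ?_
        rw [abs_mul, abs_of_nonneg (Finset.prod_nonneg fun w _ => h0 τ w _)]
    _ = ∑ τ : S → Fin q, |α τ| := by
        rw [Finset.sum_comm]
        refine Finset.sum_congr rfl fun τ _ => ?_
        have := (Finset.prod_univ_sum (fun _ : S' => (Finset.univ : Finset (Fin q))) fun w j =>
          if h : w.1.tail ∈ S then channel q lam (τ ⟨w.1.tail, h⟩) j else 1 / (q : ℝ)).symm
        rw [Fintype.piFinset_univ] at this
        rw [← Finset.mul_sum, this, Finset.prod_eq_one, mul_one]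
        intro w _
        split_ifs
        · exact sum_channel hq lam _
        · simp [hq']

/-! ### Matching attached vertices with words, integrating out the roots, counting attachments. -/

theorem exists_enumeration {n : ℕ} (v : Fin n) (T : Finset (Fin n)) :
    ∃ f : ℕ → Fin n, Set.InjOn f (Finset.range T.card) ∧ (Finset.range T.card).image f = T := by
  refine ⟨fun k => if hk : k < T.card then (T.equivFin.symm ⟨k, hk⟩).1 else v, ?_, ?_⟩
  · intro k hk k' hk' h
    simp only [Finset.coe_range, Set.mem_Iio] at hk hk'
    simp only [hk, hk', dif_pos] at h
    simpa using T.equivFin.symm.injective (Subtype.ext h)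
  · ext y
    simp only [Finset.mem_image, Finset.mem_range]
    constructor
    · rintro ⟨k, hk, rfl⟩
      simp [hk]
    · intro hy
      exact ⟨T.equivFin ⟨y, hy⟩, (T.equivFin ⟨y, hy⟩).2, by simp⟩

/-- The numbers of vertices attached to the elements of `S`. -/
def attachDegree {n : ℕ} {S : Finset (List ℕ)} (e : Fin n → Option S) (u : S) : ℕ :=
  (Finset.univ.filter fun y => e y = some u).card

/-- Extension by zero of a function on a finite set of words. -/
def extendZero {S : Finset (List ℕ)} (D : S → ℕ) (u : List ℕ) : ℕ :=
  if h : u ∈ S then D ⟨u, h⟩ else 0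

/-- The vertices of an attachment are enumerated by the next level of the forest. -/
theorem exists_embedding {n : ℕ} (v : Fin n) {S : Finset (List ℕ)} (e : Fin n → Option S) :
    ∃ ψ : List ℕ → Fin n, Set.InjOn ψ (nextLevel S (extendZero (attachDegree e))) ∧
      (∀ w ∈ nextLevel S (extendZero (attachDegree e)), ∃ hw : w.tail ∈ S,
        e (ψ w) = some ⟨w.tail, hw⟩) ∧
      ∀ y, e y ≠ none → ∃ w ∈ nextLevel S (extendZero (attachDegree e)), ψ w = y := by
  have hE := fun u : S => exists_enumeration v (Finset.univ.filter fun y => e y = some u)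
  choose f hinj himg using hE
  -- The word `k :: u` names the k-th vertex attached to `u`; `v` is only a default value.
  let ψ : List ℕ → Fin n := fun w => if h : w.tail ∈ S then f ⟨w.tail, h⟩ (w.headD 0) else v
  have hψ : ∀ (k : ℕ) (u : S), ψ (k :: u.1) = f u k := by
    intro k u
    simp [ψ]
  have hmem : ∀ w, w ∈ nextLevel S (extendZero (attachDegree e)) ↔
      ∃ (u : S) (k : ℕ), k < attachDegree e u ∧ k :: u.1 = w := by
    intro w
    rw [mem_nextLevel]
    constructor
    · rintro ⟨u, hu, k, hk, rfl⟩
      exact ⟨⟨u, hu⟩, k, by simpa [extendZero, hu] using hk, rfl⟩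
    · rintro ⟨u, k, hk, rfl⟩
      exact ⟨u, u.2, k, by simpa [extendZero] using hk, rfl⟩
  have hf : ∀ (u : S) (k : ℕ), k < attachDegree e u → e (f u k) = some u := by
    intro u k hk
    have : f u k ∈ Finset.univ.filter fun y => e y = some u := by
      rw [← himg u]
      exact Finset.mem_image_of_mem _ (Finset.mem_range.2 hk)
    simpa using this
  refine ⟨ψ, ?_, ?_, ?_⟩
  · intro w hw w' hw' h
    obtain ⟨u, k, hk, rfl⟩ := (hmem w).1 hw
    obtain ⟨u', k', hk', rfl⟩ := (hmem w').1 hw'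
    rw [hψ, hψ] at h
    have h1 := hf u k hk
    rw [h, hf u' k' hk'] at h1
    obtain rfl := Option.some.inj h1
    rw [hinj u' (Finset.mem_coe.2 (Finset.mem_range.2 hk))
      (Finset.mem_coe.2 (Finset.mem_range.2 hk')) h]
  · intro w hw
    obtain ⟨u, k, hk, rfl⟩ := (hmem w).1 hw
    exact ⟨u.2, by rw [hψ, hf u k hk]; rfl⟩
  · intro y hy
    obtain ⟨u, hu⟩ := Option.ne_none_iff_exists'.1 hy
    have : y ∈ (Finset.range (attachDegree e u)).image (f u) := by
      rw [attachDegree, himg u]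
      simpa using hu
    obtain ⟨k, hk, rfl⟩ := Finset.mem_image.1 this
    exact ⟨k :: u.1, (hmem _).2 ⟨u, k, Finset.mem_range.1 hk, rfl⟩, hψ k u⟩

theorem edgeWeight_congr {n q : ℕ} {pin pout : ℝ} {Z H : Finset (Fin n × Fin n)}
    {σ σ' : Fin n → Fin q} (h : ∀ e ∈ Z, σ e.1 = σ' e.1 ∧ σ e.2 = σ' e.2) :
    edgeWeight pin pout Z H σ = edgeWeight pin pout Z H σ' :=
  Finset.prod_congr rfl fun e he => by rw [(h e he).1, (h e he).2]

/-- Given an attachment, the labels of its roots can be integrated out. -/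
theorem graphNorm_attach {n q : ℕ} (hq : q ≠ 0) {pin pout lam x : ℝ}
    (hch : ∀ i j : Fin q, edgeProb pin pout i j = x * (q * channel q lam i j))
    {S S' : Finset (List ℕ)} (α : (S → Fin q) → ℝ) (h : Fin q → ℝ) {φ ψ : List ℕ → Fin n}
    {U : Finset (Fin n)} {v : Fin n} (hφ : Set.InjOn φ S) (hU : ∀ u ∈ S, φ u ∉ U)
    (hv : ∀ u ∈ S, φ u ≠ v) {e : Fin n → Option S} (he : ∀ y, e y ≠ none → ∀ u ∈ S, φ u ≠ y)
    (hψ : Set.InjOn ψ S') (hψe : ∀ w ∈ S', ∃ hw : w.tail ∈ S, e (ψ w) = some ⟨w.tail, hw⟩)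
    (heψ : ∀ y, e y ≠ none → ∃ w ∈ S', ψ w = y) {r : ℝ} (hr : 0 ≤ r) (hx : 0 ≤ x) :
    graphNorm pin pout (pairsIn U) (fun σ =>
      ((q : ℝ) ^ S.card * α (fun u => σ (φ u)) * h (σ v)) *
        (r * attachWeight pin pout (fun u : S => φ u) e σ)) =
      r * x ^ S'.card * graphNorm pin pout (pairsIn U) (fun σ =>
        (q : ℝ) ^ S'.card * pushLabels q lam S S' α (fun w => σ (ψ w)) * h (σ v)) := by
  have hq' : (q : ℝ) ≠ 0 := by exact_mod_cast hq
  have hφ' : Function.Injective fun u : S => φ u := fun u u' hu => Subtype.ext (hφ u.2 u'.2 hu)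
  rw [← graphNorm_const_mul (mul_nonneg hr (pow_nonneg hx _))]
  unfold graphNorm
  refine Finset.sum_congr rfl fun H _ => ?_
  congr 1
  -- Resample the labels of the roots. They lie outside `U` and differ from `v`, so they enter only
  -- through `α` and the attachment, and summing over them produces `pushLabels`.
  rw [labelAvg_extend hq _ hφ', Fintype.card_coe]
  congr 1
  funext σ
  have hoff : ∀ (s : S → Fin q) (y : Fin n), (∀ u ∈ S, φ u ≠ y) →
      Function.extend (fun u : S => φ u) s σ y = σ y := by
    intro s y hy
    apply Function.extend_apply'
    rintro ⟨u, hu⟩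
    exact hy u u.2 hu
  have hW : ∀ s : S → Fin q, edgeWeight pin pout (pairsIn U) H
      (Function.extend (fun u : S => φ u) s σ) = edgeWeight pin pout (pairsIn U) H σ := by
    intro s
    refine edgeWeight_congr fun p hp => ?_
    have hp' := (mem_pairsIn.1 hp).2
    exact ⟨hoff s _ fun u hu h => hU u hu (h ▸ hp'.1), hoff s _ fun u hu h => hU u hu (h ▸ hp'.2)⟩
  -- Each attached edge contributes x q times a channel entry: the power of x leaves the norm, and
  -- the power of q normalises the new weight as a density.
  have hA : ∀ s : S → Fin q, attachWeight pin pout (fun u : S => φ u) e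
      (Function.extend (fun u : S => φ u) s σ) = x ^ S'.card * (q : ℝ) ^ S'.card *
        ∏ w : S', if h : w.1.tail ∈ S then channel q lam (s ⟨w.1.tail, h⟩) (σ (ψ w))
          else 1 / (q : ℝ) := by
    intro s
    have h1 : attachWeight pin pout (fun u : S => φ u) e
        (Function.extend (fun u : S => φ u) s σ) =
        ∏ y ∈ S'.image ψ, (e y).elim 1 fun u => edgeProb pin pout (s u) (σ y) := by
      unfold attachWeight
      rw [← Finset.prod_subset (Finset.subset_univ (S'.image ψ))]
      · refine Finset.prod_congr rfl fun y hy => ?_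
        obtain ⟨w, hw, rfl⟩ := Finset.mem_image.1 hy
        obtain ⟨hw', hew⟩ := hψe w hw
        simp only [hew, Option.elim_some]
        rw [hoff s (ψ w) (he _ (by simp [hew])),
          hφ'.extend_apply (a := ⟨w.tail, hw'⟩)]
      · intro y _ hy
        have : e y = none := by
          by_contra hne
          obtain ⟨w, hw, rfl⟩ := heψ y hne
          exact hy (Finset.mem_image_of_mem _ hw)
        simp [this]
    rw [h1, Finset.prod_image hψ, ← Finset.prod_coe_sort, ← mul_pow, ← Fintype.card_coe,
      ← Finset.card_univ, ← Finset.prod_const, ← Finset.prod_mul_distrib]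
    refine Finset.prod_congr rfl fun w _ => ?_
    obtain ⟨hw', hew⟩ := hψe w w.2
    simp only [hew, Option.elim_some, hw', dif_pos, hch]
    ring
  simp only [hW, hA, hφ'.extend_apply, hoff _ v hv, pushLabels]
  have hqq : (1 / (q : ℝ)) ^ S.card * (q : ℝ) ^ S.card = 1 := by
    rw [← mul_pow]; simp [hq']
  rw [Finset.mul_sum, Finset.mul_sum, Finset.sum_mul, Finset.mul_sum, Finset.sum_mul]
  refine Finset.sum_congr rfl fun s _ => ?_
  linear_combination (α s * h (σ v) * (r * (x ^ S'.card * (q : ℝ) ^ S'.card *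
        ∏ w : S', if h : w.1.tail ∈ S then channel q lam (s ⟨w.1.tail, h⟩) (σ (ψ w))
          else 1 / (q : ℝ))) * edgeWeight pin pout (pairsIn U) H σ) * hqq

/-- An attachment is determined by its fibres; their disjointness is forgotten in the count. -/
theorem card_attachments_le {n : ℕ} {S : Finset (List ℕ)} (T : Finset (Fin n)) (D : S → ℕ) :
    ((attachments S T).filter fun e => attachDegree e = D).card ≤ ∏ u, n.choose (D u) := by
  have h : (Fintype.piFinset fun u : S =>
      Finset.powersetCard (D u) (Finset.univ : Finset (Fin n))).card = ∏ u, n.choose (D u) := by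
    simp [Fintype.card_piFinset, Finset.card_powersetCard]
  rw [← h]
  refine Finset.card_le_card_of_injOn
    (fun e u => Finset.univ.filter fun y => e y = some u) ?_ ?_
  · intro e he
    have he' := (Finset.mem_filter.1 (Finset.mem_coe.1 he)).2
    rw [Finset.mem_coe, Fintype.mem_piFinset]
    intro u
    rw [Finset.mem_powersetCard]
    exact ⟨Finset.subset_univ _, congrFun he' u⟩
  · intro e _ e' _ hee
    funext y
    ext u
    have := congrFun hee u
    simp only [Finset.ext_iff, Finset.mem_filter, Finset.mem_univ, true_and] at this
    exact this y

theorem poissonGW_lintegral_restrict (d : ℝ) {S : Finset (List ℕ)} (F : (S → ℕ) → ENNReal) :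
    ∫⁻ N, F (S.restrict N) ∂poissonGW d.toNNReal =
      ∑' D : S → ℕ, F D * ∏ u, poissonMeasure d.toNNReal {D u} := by
  unfold poissonGW
  rw [lintegral_restrict_infinitePi (μ := fun _ : List ℕ => poissonMeasure d.toNNReal)
    (s := S) (measurable_of_countable F), lintegral_countable']
  simp [Measure.pi_singleton]

/-- Summing over attachments is dominated by a Poisson expectation. -/
theorem sum_attachments_le {n : ℕ} (hn : n ≠ 0) {d : ℝ} (hd : 0 ≤ d) {S : Finset (List ℕ)}
    (T : Finset (Fin n)) (F : (S → ℕ) → ENNReal) :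
    ∑ e ∈ attachments S T, ENNReal.ofReal (Real.exp (-(d * Fintype.card S)) *
      (d / n) ^ (∑ u, attachDegree e u)) * F (attachDegree e) ≤
    ∫⁻ N, F (S.restrict N) ∂poissonGW d.toNNReal := by
  have hn' : (0 : ℝ) < n := by positivity
  rw [poissonGW_lintegral_restrict]
  set I := (attachments S T).image attachDegree with hI
  rw [← Finset.sum_fiberwise_of_maps_to (t := I) (g := attachDegree)
    fun e he => Finset.mem_image_of_mem _ he]
  refine le_trans (Finset.sum_le_sum fun D _ => ?_) (ENNReal.sum_le_tsum I)
  calc ∑ e ∈ attachments S T with attachDegree e = D, ENNReal.ofReal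
        (Real.exp (-(d * Fintype.card S)) * (d / n) ^ (∑ u, attachDegree e u)) *
          F (attachDegree e)
      = ∑ e ∈ attachments S T with attachDegree e = D, ENNReal.ofReal
        (Real.exp (-(d * Fintype.card S)) * (d / n) ^ (∑ u, D u)) * F D := by
        refine Finset.sum_congr rfl fun e he => ?_
        rw [(Finset.mem_filter.1 he).2]
    _ = F D * (((attachments S T).filter fun e => attachDegree e = D).card * ENNReal.ofReal
        (Real.exp (-(d * Fintype.card S)) * (d / n) ^ (∑ u, D u))) := by
        rw [Finset.sum_const, nsmul_eq_mul]
        ring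
    _ ≤ _ := by
        gcongr
        simp only [poissonMeasure_singleton]
        rw [← ENNReal.ofReal_prod_of_nonneg fun u _ => by positivity, ← ENNReal.ofReal_natCast,
          ← ENNReal.ofReal_mul (by positivity)]
        refine ENNReal.ofReal_le_ofReal ?_
        -- The binomials are at most n^D / D!, so the powers of n cancel and the Poisson weights
        -- e^{-d} d^D / D! remain.
        calc _ ≤ (∏ u, ((n : ℝ) ^ D u / (D u).factorial)) *
              (Real.exp (-(d * Fintype.card S)) * (d / n) ^ (∑ u, D u)) := by
              gcongr
              refine (Nat.cast_le.2 (card_attachments_le T D)).trans ?_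
              push_cast
              exact Finset.prod_le_prod (fun _ _ => by positivity) fun u _ =>
                Nat.choose_le_pow_div _ _
          _ = _ := by
              have h1 : Real.exp (-(d * Fintype.card S)) = ∏ _u : S, Real.exp (-d) := by
                rw [Finset.prod_const, ← Real.exp_nat_mul, Finset.card_univ]
                congr 1
                ring
              rw [h1, ← Finset.prod_pow_eq_pow_sum, ← Finset.prod_mul_distrib,
                ← Finset.prod_mul_distrib]
              refine Finset.prod_congr rfl fun u _ => ?_
              rw [Real.coe_toNNReal d hd, div_pow]
              field_simp

/-- The error in the exploration of a level with `k` vertices, when `K` vertices have already been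
removed. -/
def levelError (q : ℕ) (c d : ℝ) (k K n : ℕ) : ℝ :=
  -- The factor 2 q^k bounds the signed density pointwise. The count K + k + 1 bounds the vertices
  -- that cannot be attached: those removed, the level itself and the vertex `v`.
  (q : ℝ) ^ k * 2 *
    √(8 * ((k * c ^ 2 + (k * c) ^ 2 + k * d * ((K + k + 1 : ℕ) : ℝ)) / n))

/-- The recursion behind the proof. Replacing the law of the revealed pairs by the forest costs
`levelError`; each attachment then gives an instance of the norm of the next state in the graph
without the current level, and the supremum absorbs the choice of embedding. -/
theorem forestNorm_le_step {n q : ℕ} (hq : q ≠ 0) (hn : n ≠ 0) {pin pout c d lam : ℝ}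
    (hin : 0 ≤ pin) (hout : 0 ≤ pout) (hinc : pin ≤ c / n) (houtc : pout ≤ c / n)
    (hc : c / n ≤ 1 / 2) (hd : (pin + ((q : ℝ) - 1) * pout) / q = d / n) (hd0 : 0 ≤ d)
    (hch : ∀ i j : Fin q, edgeProb pin pout i j = (d / n) * (q * channel q lam i j))
    {h : Fin q → ℝ} (hh : ∀ i, |h i| ≤ 1) (s : ForestState q)
    (hs : ∑ τ, |s.weight τ| ≤ 2) :
    forestNorm n pin pout h s ≤
      ENNReal.ofReal (levelError q c d s.level.card s.removed n) +
        ∫⁻ N, forestNorm n pin pout h (s.step lam N) ∂poissonGW d.toNNReal := by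
  have hn' : (0 : ℝ) < n := by positivity
  have hin1 : pin ≤ 1 := by linarith
  have hout1 : pout ≤ 1 := by linarith
  refine iSup_le fun U => iSup_le fun v => iSup_le fun φ => iSup_le fun hφ => iSup_le fun hU =>
    iSup_le fun hcard => ?_
  set S := s.level with hS
  set k : ℕ := S.card with hk
  have hφ' : Function.Injective fun u : S => φ u := fun u u' hu => Subtype.ext (hφ u.2 u'.2 hu)
  set W := S.image φ with hW
  set U' := U \ W with hU'
  -- The ideal forest never reaches `v`, so the factor `h (σ v)` survives the step unchanged. Only
  -- attaching is forbidden: `v` is not deleted from `U'`.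
  set T := U'.erase v with hT
  have hTφ : ∀ u : S, φ u ∉ T := by
    intro u hu
    have := (Finset.mem_sdiff.1 (Finset.mem_of_mem_erase hu)).2
    exact this (Finset.mem_image_of_mem _ u.2)
  have hUφ : ∀ u ∈ S, φ u ∉ U' := fun u hu h' =>
    (Finset.mem_sdiff.1 h').2 (Finset.mem_image_of_mem _ hu)
  have hWc : W.card ≤ k := Finset.card_image_le
  have hUc' : U.card ≤ U'.card + k := by
    have : U.card - W.card ≤ U'.card := Finset.le_card_sdiff W U
    omega
  have hTc : n ≤ T.card + (s.removed + k + 1) := by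
    have : U'.card - 1 ≤ T.card := Finset.pred_card_le_card_erase
    omega
  set Z₂ := pairsIn U' with hZ₂
  -- These are the pairs of `U` with at least one end in the level.
  set Z₁ := pairsIn U \ Z₂ with hZ₁
  have hZ : pairsIn U = Z₁ ∪ Z₂ := by
    rw [hZ₁, Finset.sdiff_union_of_subset]
    intro p hp
    have := mem_pairsIn.1 hp
    exact mem_pairsIn.2 ⟨this.1, Finset.sdiff_subset this.2.1, Finset.sdiff_subset this.2.2⟩
  have hZd : Disjoint Z₁ Z₂ := Finset.sdiff_disjoint
  have hZne : ∀ p ∈ Z₁, p.1 ≠ p.2 := fun p hp =>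
    (mem_pairsIn.1 (Finset.sdiff_subset hp)).1.ne
  have hZc : (Z₁.card : ℝ) ≤ Fintype.card S * n := by
    have h1 : Z₁ ⊆ (W ×ˢ (Finset.univ : Finset (Fin n))).image fun p => sortedPair p.1 p.2 := by
      intro p hp
      obtain ⟨hp1, hp2⟩ := Finset.mem_sdiff.1 hp
      obtain ⟨hlt, ha, hb⟩ := mem_pairsIn.1 hp1
      by_cases hpa : p.1 ∈ W
      · refine Finset.mem_image.2 ⟨(p.1, p.2), by simp [hpa], ?_⟩
        simp [sortedPair, hlt.le]
      · have hpb : p.2 ∈ W := by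
          by_contra hpb
          exact hp2 (mem_pairsIn.2 ⟨hlt, Finset.mem_sdiff.2 ⟨ha, hpa⟩, Finset.mem_sdiff.2 ⟨hb, hpb⟩⟩)
        refine Finset.mem_image.2 ⟨(p.2, p.1), by simp [hpb], ?_⟩
        simp [sortedPair, hlt.le]
    have h2 : Z₁.card ≤ k * n := by
      refine (Finset.card_le_card h1).trans (Finset.card_image_le.trans ?_)
      rw [Finset.card_product, Finset.card_univ, Fintype.card_fin]
      gcongr
    rw [Fintype.card_coe]
    exact_mod_cast h2
  have hTZ : ∀ e ∈ attachments S T, attachedEdges (fun u : S => φ u) e ⊆ Z₁ := by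
    intro e he p hp
    obtain ⟨y, u, hyu, rfl⟩ := mem_attachedEdges.1 hp
    have hyT := mem_of_mem_attachments he (y := y) (by simp [hyu])
    have hyU : y ∈ U := Finset.sdiff_subset (Finset.mem_of_mem_erase hyT)
    have hne : φ u ≠ y := fun h' => hTφ u (h' ▸ hyT)
    have huU := (hU u u.2).1
    rw [Finset.mem_sdiff]
    rcases lt_or_gt_of_ne hne with hlt | hlt
    · simp [sortedPair, hlt.le, hZ₂, mem_pairsIn, hlt, hyU, huU, hUφ u u.2]
    · simp [sortedPair, hlt.le, hZ₂, mem_pairsIn, hlt, hyU, huU, hUφ u u.2]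
  have hTn : (n : ℝ) ≤ T.card + ((s.removed + k + 1 : ℕ) : ℝ) := by exact_mod_cast hTc
  have herr := labelAvg_sum_abs_sub_le hq hn hin hout hinc houtc hc hd hd0 (fun u : S => φ u) hφ'
    hTφ hTn hZne hZc hTZ
  set A : (Fin n → Fin q) → ℝ := fun σ =>
    (q : ℝ) ^ S.card * s.weight (fun u => σ (φ u)) * h (σ v) with hA
  have hAle : ∀ σ, |A σ| ≤ (q : ℝ) ^ k * 2 := by
    intro σ
    rw [hA, abs_mul, abs_mul, abs_of_nonneg (by positivity : (0 : ℝ) ≤ (q : ℝ) ^ S.card)]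
    refine (mul_le_of_le_one_right (by positivity) (hh _)).trans ?_
    gcongr
    exact (Finset.single_le_sum (f := fun τ => |s.weight τ|) (fun _ _ => abs_nonneg _)
      (Finset.mem_univ _)).trans hs
  have hmain : graphNorm pin pout (pairsIn U) A ≤ levelError q c d k s.removed n +
      ∑ e ∈ attachments S T, graphNorm pin pout Z₂ fun σ => A σ *
        (Real.exp (-(d * Fintype.card S)) * attachWeight pin pout (fun u : S => φ u) e σ) := by
    rw [hZ, graphNorm_union hZd]
    calc ∑ H ∈ Z₁.powerset, graphNorm pin pout Z₂ (fun σ => A σ * edgeWeight pin pout Z₁ H σ)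
        ≤ ∑ H ∈ Z₁.powerset, (labelAvg (fun σ => ((q : ℝ) ^ k * 2) *
            |edgeWeight pin pout Z₁ H σ - forestWeight pin pout d (fun u : S => φ u) T H σ|) +
          ∑ e ∈ attachments S T with attachedEdges (fun u : S => φ u) e = H,
            graphNorm pin pout Z₂ fun σ => A σ *
              (Real.exp (-(d * Fintype.card S)) *
                attachWeight pin pout (fun u : S => φ u) e σ)) := by
          refine Finset.sum_le_sum fun H _ => ?_
          -- The difference of the two laws is bounded through |A| ≤ 2 q^k, while the forest part is
          -- split over attachments, keeping the signs inside each norm.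
          have hsplit : (fun σ => A σ * edgeWeight pin pout Z₁ H σ) = fun σ =>
              A σ * (edgeWeight pin pout Z₁ H σ -
                forestWeight pin pout d (fun u : S => φ u) T H σ) +
              ∑ e ∈ attachments S T with attachedEdges (fun u : S => φ u) e = H,
                A σ * (Real.exp (-(d * Fintype.card S)) *
                  attachWeight pin pout (fun u : S => φ u) e σ) := by
            funext σ
            rw [← Finset.mul_sum, ← forestWeight]
            ring
          rw [hsplit]
          refine (graphNorm_add_le _ _ _).trans (add_le_add ?_ (graphNorm_sum_le _ _ _))
          refine (graphNorm_le hin hout hin1 hout1 _ _).trans (labelAvg_mono fun σ => ?_)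
          rw [abs_mul]
          gcongr
          exact hAle σ
      _ ≤ _ := by
          rw [Finset.sum_add_distrib, Finset.sum_fiberwise_of_maps_to
            fun e he => Finset.mem_powerset.2 (hTZ e he)]
          simp only [labelAvg_const_mul]
          rw [← Finset.mul_sum, ← labelAvg_sum, levelError]
          gcongr
          rw [Fintype.card_coe] at herr
          exact herr
  have hlev : 0 ≤ levelError q c d k s.removed n :=
    mul_nonneg (mul_nonneg (pow_nonneg (Nat.cast_nonneg q) k) zero_le_two) (Real.sqrt_nonneg _)
  refine (ENNReal.ofReal_le_ofReal hmain).trans ?_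
  rw [ENNReal.ofReal_add hlev (Finset.sum_nonneg fun _ _ => graphNorm_nonneg _ _),
    ENNReal.ofReal_sum_of_nonneg fun _ _ => graphNorm_nonneg _ _]
  gcongr
  have hint : ∫⁻ N, forestNorm n pin pout h (s.step lam N) ∂poissonGW d.toNNReal =
      ∫⁻ N, (fun D : S → ℕ => forestNorm n pin pout h (s.step lam (extendZero D)))
        (S.restrict N) ∂poissonGW d.toNNReal := by
    refine lintegral_congr fun N => ?_
    rw [s.step_congr lam (N' := extendZero (S.restrict N))]
    intro u hu
    have hu' : u ∈ S := hu
    simp [extendZero, hu']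
  rw [hint]
  refine le_trans (Finset.sum_le_sum fun e he => ?_)
    (sum_attachments_le hn hd0 T fun D : S → ℕ => forestNorm n pin pout h
      (s.step lam (extendZero D)))
  obtain ⟨ψ, hψ, hψe, heψ⟩ := exists_embedding v e
  have hψT : ∀ w ∈ nextLevel S (extendZero (attachDegree e)), ψ w ∈ T := by
    intro w hw
    obtain ⟨hw', hew⟩ := hψe w hw
    exact mem_of_mem_attachments he (by simp [hew])
  have hcardS' : (nextLevel S (extendZero (attachDegree e))).card = ∑ u, attachDegree e u := by
    rw [card_nextLevel, ← Finset.sum_coe_sort]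
    refine Finset.sum_congr rfl fun u _ => ?_
    simp [extendZero]
  rw [hA, graphNorm_attach hq hch s.weight h hφ hUφ (fun u hu => (hU u hu).2)
    (fun y hy u hu huy => hTφ ⟨u, hu⟩ (by simpa [huy] using mem_of_mem_attachments he hy))
    hψ hψe heψ (Real.exp_pos _).le (by positivity), hcardS',
    ENNReal.ofReal_mul (by positivity)]
  gcongr
  refine le_trans (le_of_eq ?_) (le_forestNorm (s := s.step lam (extendZero (attachDegree e)))
    (U := U') (v := v) (φ := ψ) hψ ?_ ?_)
  · rw [← hcardS']
    rfl
  · intro w hw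
    have := Finset.mem_erase.1 (hψT w hw)
    exact ⟨this.2, this.1⟩
  · change n ≤ U'.card + (s.removed + k)
    omega

/-! ### Exploration of several levels -/

/-- A function of the offspring numbers which locally depends on finitely many of them is
measurable. -/
theorem measurable_of_finite_dependence {β : Type*} [MeasurableSpace β]
    {f : (List ℕ → ℕ) → β}
    (hf : ∀ N, ∃ F : Finset (List ℕ), ∀ N', (∀ u ∈ F, N' u = N u) → f N' = f N) :
    Measurable f := by
  intro s _
  -- Local dependence on finitely many coordinates makes the preimage of any set whatsoever open for
  -- the product of discrete topologies.
  refine IsOpen.measurableSet (isOpen_pi_iff.2 fun N hN => ?_)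
  obtain ⟨F, hF⟩ := hf N
  refine ⟨F, fun u => {N u}, fun u _ => ⟨isOpen_discrete _, rfl⟩, fun N' hN' => ?_⟩
  rw [Set.mem_preimage, hF N' fun u hu => hN' u hu]
  exact hN

/-- The state of the exploration of the tree `N` after `m` levels. -/
def exploredState {q : ℕ} (lam : ℝ) (s : ForestState q) (N : List ℕ → ℕ) : ℕ → ForestState q
  | 0 => s
  | m + 1 => (exploredState lam s N m).step lam N

theorem exploredState_finite_dependence {q : ℕ} (lam : ℝ) (s : ForestState q) (m : ℕ)
    (N : List ℕ → ℕ) : ∃ F : Finset (List ℕ), ∀ N', (∀ u ∈ F, N' u = N u) →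
      exploredState lam s N' m = exploredState lam s N m := by
  induction m with
  | zero => exact ⟨∅, fun _ _ => rfl⟩
  | succ m ih =>
    obtain ⟨F, hF⟩ := ih
    refine ⟨F ∪ (exploredState lam s N m).level, fun N' hN' => ?_⟩
    simp only [exploredState]
    rw [hF N' fun u hu => hN' u (Finset.mem_union_left _ hu)]
    exact ForestState.step_congr _ _ fun u hu => hN' u (Finset.mem_union_right _ hu)

theorem measurable_comp_exploredState {q : ℕ} {β : Type*} [MeasurableSpace β]
    (g : ForestState q → β) (lam : ℝ) (s : ForestState q) (m : ℕ) :
    Measurable fun N => g (exploredState lam s N m) := by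
  refine measurable_of_finite_dependence fun N => ?_
  obtain ⟨F, hF⟩ := exploredState_finite_dependence lam s m N
  exact ⟨F, fun N' hN' => by rw [hF N' hN']⟩

theorem length_of_mem_exploredState {q : ℕ} {lam : ℝ} {s : ForestState q}
    (hs : s.level = {[]}) (N : List ℕ → ℕ) (m : ℕ) :
    ∀ u ∈ (exploredState lam s N m).level, u.length = m := by
  induction m with
  | zero =>
    intro u hu
    have : u ∈ s.level := hu
    simp_all
  | succ m ih =>
    intro u hu
    obtain ⟨u', hu', k, -, rfl⟩ := mem_nextLevel.1 hu
    simp [ih u' hu']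

theorem exploredState_congr {q : ℕ} {lam : ℝ} {s : ForestState q} (hs : s.level = {[]})
    {N N' : List ℕ → ℕ} (m : ℕ) (h : ∀ u, u.length < m → N u = N' u) :
    exploredState lam s N m = exploredState lam s N' m := by
  induction m with
  | zero => rfl
  | succ m ih =>
    simp only [exploredState]
    rw [← ih fun u hu => h u (by omega)]
    refine ForestState.step_congr _ _ fun u hu => h u ?_
    rw [length_of_mem_exploredState hs N m u hu]
    omega

/-- The offspring numbers given by `N` on the first `m` levels and by `N'` on the other ones. -/
def glueOffspring (m : ℕ) (x : (List ℕ → ℕ) × (List ℕ → ℕ)) (u : List ℕ) : ℕ :=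
  if u.length < m then x.1 u else x.2 u

theorem measurable_glueOffspring (m : ℕ) : Measurable (glueOffspring m) := by
  refine measurable_pi_lambda _ fun u => ?_
  unfold glueOffspring
  split_ifs
  · exact (measurable_pi_apply u).comp measurable_fst
  · exact (measurable_pi_apply u).comp measurable_snd

instance (d : ℝ≥0) : IsProbabilityMeasure (poissonGW d) := by
  unfold poissonGW
  infer_instance

/-- Redrawing the offspring from level `m` on does not change the law of the tree; this supplies the
independence needed to iterate the one-level bound. -/
theorem map_glueOffspring (d : ℝ≥0) (m : ℕ) :
    ((poissonGW d).prod (poissonGW d)).map (glueOffspring m) = poissonGW d := by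
  conv_rhs => rw [poissonGW]
  refine Measure.eq_infinitePi _ fun s t ht => ?_
  rw [Measure.map_apply (measurable_glueOffspring m)
    (MeasurableSet.pi s.countable_toSet fun u _ => ht u)]
  have h : glueOffspring m ⁻¹' Set.pi s t =
      (Set.pi (s.filter fun u => u.length < m) t) ×ˢ
        (Set.pi (s.filter fun u => ¬ u.length < m) t) := by
    ext x
    simp only [Set.mem_preimage, Set.mem_pi, Set.mem_prod, Finset.mem_coe, Finset.mem_filter,
      glueOffspring]
    constructor
    · intro hx
      refine ⟨fun u hu => ?_, fun u hu => ?_⟩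
      · simpa [hu.2] using hx u hu.1
      · simpa [hu.2] using hx u hu.1
    · rintro ⟨h1, h2⟩ u hu
      split_ifs with hl
      · exact h1 u ⟨hu, hl⟩
      · exact h2 u ⟨hu, hl⟩
  rw [h, Measure.prod_prod, poissonGW, Measure.infinitePi_pi _ fun u _ => ht u,
    Measure.infinitePi_pi _ fun u _ => ht u, Finset.prod_filter_mul_prod_filter_not]

/-- The offspring numbers of a level are independent of the previous levels. -/
theorem lintegral_exploredState_succ {q : ℕ} (g : ForestState q → ENNReal) (lam : ℝ)
    {s : ForestState q} (hs : s.level = {[]}) (d : ℝ≥0) (m : ℕ) :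
    ∫⁻ N, g (exploredState lam s N (m + 1)) ∂poissonGW d =
      ∫⁻ N, ∫⁻ N', g ((exploredState lam s N m).step lam N') ∂poissonGW d ∂poissonGW d := by
  have hm := measurable_comp_exploredState g lam s (m + 1)
  have hmc : Measurable fun x => g (exploredState lam s (glueOffspring m x) (m + 1)) :=
    hm.comp (measurable_glueOffspring m)
  conv_lhs => rw [← map_glueOffspring d m]
  rw [lintegral_map hm (measurable_glueOffspring m), lintegral_prod _ hmc.aemeasurable]
  refine lintegral_congr fun N => lintegral_congr fun N' => ?_
  congr 1
  simp only [exploredState]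
  rw [← exploredState_congr hs (N := N) m fun u hu => by simp [glueOffspring, hu]]
  refine ForestState.step_congr _ _ fun u hu => ?_
  have := length_of_mem_exploredState hs N m u hu
  simp [glueOffspring, this]

theorem sum_abs_exploredState_le {q : ℕ} (hq : q ≠ 0) {lam : ℝ}
    (hch : ∀ i j, 0 ≤ channel q lam i j) {s : ForestState q} {C : ℝ}
    (hs : ∑ τ, |s.weight τ| ≤ C) (N : List ℕ → ℕ) (m : ℕ) :
    ∑ τ, |(exploredState lam s N m).weight τ| ≤ C := by
  induction m with
  | zero => exact hs
  | succ m ih => exact (sum_abs_pushLabels_le hq hch _ _ _).trans ih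

theorem tendsto_levelError (q : ℕ) (c d : ℝ) (k K : ℕ) :
    Tendsto (fun n => levelError q c d k K n) atTop (nhds 0) := by
  unfold levelError
  have h1 : Tendsto (fun n : ℕ => 8 * (((k : ℝ) * c ^ 2 + (k * c) ^ 2 +
      k * d * ((K + k + 1 : ℕ) : ℝ)) / n)) atTop (nhds (8 * 0)) :=
    (tendsto_const_div_atTop_nhds_zero_nat _).const_mul 8
  have h2 := ((Real.continuous_sqrt.tendsto _).comp h1).const_mul ((q : ℝ) ^ k * 2)
  simpa using h2

/-- Iteration of the one-level bound. The error is truncated at 2 because the norm never exceeds the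
mass of the weight; this provides the domination for letting n → ∞ under the integral. -/
theorem forestNorm_le_explored {n q : ℕ} (hq : q ≠ 0) (hn : n ≠ 0) {pin pout c d lam : ℝ}
    (hin : 0 ≤ pin) (hout : 0 ≤ pout) (hinc : pin ≤ c / n) (houtc : pout ≤ c / n)
    (hc : c / n ≤ 1 / 2) (hd : (pin + ((q : ℝ) - 1) * pout) / q = d / n) (hd0 : 0 ≤ d)
    (hch : ∀ i j : Fin q, edgeProb pin pout i j = (d / n) * (q * channel q lam i j))
    (hch0 : ∀ i j, 0 ≤ channel q lam i j)
    {h : Fin q → ℝ} (hh : ∀ i, |h i| ≤ 1) {s : ForestState q} (hl : s.level = {[]})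
    (hs : ∑ τ, |s.weight τ| ≤ 2) (m : ℕ) :
    forestNorm n pin pout h s ≤ ∑ l ∈ Finset.range m,
        ∫⁻ N, min (ENNReal.ofReal (levelError q c d (exploredState lam s N l).level.card
          (exploredState lam s N l).removed n)) 2 ∂poissonGW d.toNNReal +
      ∫⁻ N, forestNorm n pin pout h (exploredState lam s N m) ∂poissonGW d.toNNReal := by
  induction m with
  | zero => simp [exploredState]
  | succ m ih =>
    refine ih.trans ?_
    rw [Finset.sum_range_succ, add_assoc, lintegral_exploredState_succ _ lam hl,
      ← lintegral_add_left (measurable_comp_exploredState (fun s' => min (ENNReal.ofReal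
        (levelError q c d s'.level.card s'.removed n)) 2) lam s m)]
    gcongr with N
    have hw := sum_abs_exploredState_le hq hch0 hs N m
    rcases min_choice (ENNReal.ofReal (levelError q c d (exploredState lam s N m).level.card
      (exploredState lam s N m).removed n)) 2 with h' | h'
    · rw [h']
      exact forestNorm_le_step hq hn hin hout hinc houtc hc hd hd0 hch hh _ hw
    · rw [h']
      refine le_trans ?_ le_self_add
      refine (forestNorm_le hq hin hout (by linarith) (by linarith) hh _).trans ?_
      calc _ ≤ ENNReal.ofReal 2 := ENNReal.ofReal_le_ofReal hw
        _ = 2 := by simp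

/-- If the labels of the far levels of the Poisson tree are asymptotically uninformative, then
so is the graph. -/
theorem tendsto_forestNorm {q : ℕ} (hq : q ≠ 0) {a b c d lam : ℝ} (ha : 0 ≤ a) (hb : 0 ≤ b)
    (hac : a ≤ c) (hbc : b ≤ c) (hd : (a + ((q : ℝ) - 1) * b) / q = d) (hd0 : 0 ≤ d)
    (hch : ∀ i j : Fin q, edgeProb a b i j = d * (q * channel q lam i j))
    (hch0 : ∀ i j, 0 ≤ channel q lam i j)
    {h : Fin q → ℝ} (hh : ∀ i, |h i| ≤ 1) {s : ForestState q} (hl : s.level = {[]})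
    (hs : ∑ τ, |s.weight τ| ≤ 2)
    (hlim : Tendsto (fun m => ∫⁻ N, ENNReal.ofReal (∑ τ, |(exploredState lam s N m).weight τ|)
      ∂poissonGW d.toNNReal) atTop (nhds 0)) :
    Tendsto (fun n : ℕ => forestNorm n (a / n) (b / n) h s) atTop (nhds 0) := by
  rw [ENNReal.tendsto_nhds_zero]
  intro ε hε
  have hε2 : 0 < ε / 2 := ENNReal.half_pos hε.ne'
  -- The depth is fixed before n grows, so no control on growing neighbourhoods is needed.
  obtain ⟨m, hm⟩ := ((ENNReal.tendsto_nhds_zero.1 hlim) (ε / 2) hε2).exists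
  have herr : Tendsto (fun n : ℕ => ∑ l ∈ Finset.range m,
      ∫⁻ N, min (ENNReal.ofReal (levelError q c d (exploredState lam s N l).level.card
        (exploredState lam s N l).removed n)) 2 ∂poissonGW d.toNNReal) atTop (nhds 0) := by
    refine (tendsto_finsetSum _ fun l _ => ?_).trans (by rw [Finset.sum_const_zero])
    have hz : ∫⁻ _ : List ℕ → ℕ, (0 : ENNReal) ∂poissonGW d.toNNReal = 0 := lintegral_zero
    rw [← hz]
    refine tendsto_lintegral_of_dominated_convergence (fun _ => 2)
      (fun n => measurable_comp_exploredState (fun s' => min (ENNReal.ofReal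
        (levelError q c d s'.level.card s'.removed n)) 2) lam s l)
      (fun n => Eventually.of_forall fun N => min_le_right _ _) (by simp) ?_
    refine Eventually.of_forall fun N => ?_
    have h1 := (ENNReal.continuous_ofReal.tendsto _).comp
      (tendsto_levelError q c d (exploredState lam s N l).level.card
        (exploredState lam s N l).removed)
    rw [ENNReal.ofReal_zero] at h1
    simpa using h1.min (tendsto_const_nhds (x := (2 : ENNReal)))
  have hc : ∀ᶠ n : ℕ in atTop, c / n ≤ 1 / 2 :=
    (tendsto_const_div_atTop_nhds_zero_nat c).eventually (ge_mem_nhds (by norm_num))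
  filter_upwards [(ENNReal.tendsto_nhds_zero.1 herr) (ε / 2) hε2, hc, eventually_ne_atTop 0]
    with n h1 h2 hn
  have hn' : (0 : ℝ) < n := by positivity
  have hinc : a / n ≤ c / n := by gcongr
  have houtc : b / n ≤ c / n := by gcongr
  refine (forestNorm_le_explored (c := c) (d := d) (lam := lam) hq hn (div_nonneg ha hn'.le)
    (div_nonneg hb hn'.le) hinc houtc h2 ?_ hd0 ?_ hch0 hh hl hs m).trans ?_
  · rw [← hd]
    field_simp
  · intro i j
    have : edgeProb (a / n) (b / n) i j = edgeProb a b i j / n := by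
      unfold edgeProb; split_ifs <;> rfl
    rw [this, hch]
    ring
  · calc _ ≤ ε / 2 + ε / 2 := by
          gcongr
          refine le_trans (lintegral_mono fun N => ?_) hm
          exact forestNorm_le hq (div_nonneg ha hn'.le) (div_nonneg hb hn'.le) (by linarith)
            (by linarith) hh _
      _ = ε := ENNReal.add_halves ε

/-! ### The laws of the levels of a tree -/

theorem length_of_mem_treeLevel {N : List ℕ → ℕ} {n : ℕ} :
    ∀ {w : List ℕ}, w ∈ treeLevel N n → w.length = n := by
  induction n with
  | zero => intro w hw; simp [treeLevel] at hw; simp [hw]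
  | succ n ih =>
    intro w hw
    obtain ⟨u, hu, k, -, rfl⟩ :=
      mem_nextLevel.1 (show w ∈ nextLevel (treeLevel N n) N from hw)
    simp [ih hu]

theorem tail_mem_treeLevel {N : List ℕ → ℕ} {n : ℕ} {w : List ℕ} (hw : w ∈ treeLevel N (n + 1)) :
    w.tail ∈ treeLevel N n :=
  tail_mem_of_mem_nextLevel (S := treeLevel N n) (N := N) hw

theorem mem_treeBall {N : List ℕ → ℕ} {n : ℕ} {w : List ℕ} :
    w ∈ treeBall N n ↔ ∃ m ≤ n, w ∈ treeLevel N m := by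
  simp [treeBall]

theorem tail_mem_treeBall {N : List ℕ → ℕ} {n : ℕ} {w : List ℕ} (hw : w ∈ treeBall N n) :
    w.tail ∈ treeBall N n := by
  obtain ⟨m, hm, hw⟩ := mem_treeBall.1 hw
  cases m with
  | zero =>
    simp only [treeLevel, Finset.mem_singleton] at hw
    subst hw
    exact root_mem_treeBall N n
  | succ m => exact mem_treeBall.2 ⟨m, by omega, tail_mem_treeLevel hw⟩

theorem treeBall_succ (N : List ℕ → ℕ) (n : ℕ) :
    treeBall N (n + 1) = treeBall N n ∪ treeLevel N (n + 1) := by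
  ext w
  simp only [mem_treeBall, Finset.mem_union]
  constructor
  · rintro ⟨m, hm, hw⟩
    rcases Nat.lt_or_ge n m with h | h
    · obtain rfl : m = n + 1 := by omega
      exact Or.inr hw
    · exact Or.inl ⟨m, h, hw⟩
  · rintro (⟨m, hm, hw⟩ | hw)
    · exact ⟨m, by omega, hw⟩
    · exact ⟨n + 1, le_rfl, hw⟩

theorem disjoint_treeBall_treeLevel (N : List ℕ → ℕ) (n : ℕ) :
    Disjoint (treeBall N n) (treeLevel N (n + 1)) := by
  rw [Finset.disjoint_left]
  intro w hw hw'
  obtain ⟨m, hm, hw⟩ := mem_treeBall.1 hw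
  have := length_of_mem_treeLevel hw
  have := length_of_mem_treeLevel hw'
  omega

theorem treeBall_subset_succ (N : List ℕ → ℕ) (n : ℕ) : treeBall N n ⊆ treeBall N (n + 1) := by
  rw [treeBall_succ]
  exact Finset.subset_union_left

/-- Every vertex other than the root has exactly one parent, its tail, so the product over pairs
collapses to one over vertices. -/
theorem broadcastProb_eq (q : ℕ) (lam : ℝ) (N : List ℕ → ℕ) (n : ℕ) (σ : treeBall N n → Fin q) :
    broadcastProb q lam N n σ = (1 / (q : ℝ)) * ∏ w : treeBall N n,
      if w.1 = [] then 1 else channel q lam (σ ⟨w.1.tail, tail_mem_treeBall w.2⟩) (σ w) := by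
  unfold broadcastProb
  congr 1
  rw [Finset.prod_filter, Fintype.prod_prod_type_right]
  refine Finset.prod_congr rfl fun w _ => ?_
  split_ifs with hw
  · refine Finset.prod_eq_one fun x _ => ?_
    rw [if_neg]
    simp [hw]
  · rw [Finset.prod_eq_single ⟨w.1.tail, tail_mem_treeBall w.2⟩]
    · rw [if_pos]
      exact ⟨w.1.head hw, (List.cons_head_tail hw).symm⟩
    · intro x _ hx
      rw [if_neg]
      rintro ⟨k, hk⟩
      apply hx
      ext1
      simp only at hk
      simp [hk]
    · simp

theorem broadcastProb_succ (q : ℕ) (lam : ℝ) (N : List ℕ → ℕ) (n : ℕ)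
    (σ : treeBall N (n + 1) → Fin q) :
    broadcastProb q lam N (n + 1) σ =
      broadcastProb q lam N n (fun w => σ ⟨w.1, treeBall_subset_succ N n w.2⟩) *
        ∏ w : treeLevel N (n + 1), channel q lam
          (σ ⟨w.1.tail, tail_mem_treeBall (treeLevel_subset_treeBall N le_rfl w.2)⟩)
          (σ ⟨w.1, treeLevel_subset_treeBall N le_rfl w.2⟩) := by
  -- A function on all words, so that splitting the ball does not change the domain of the labels.
  let F : List ℕ → ℝ := fun w => if h : w ∈ treeBall N (n + 1) then
    (if w = [] then 1 else channel q lam (σ ⟨w.tail, tail_mem_treeBall h⟩) (σ ⟨w, h⟩)) else 1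
  rw [broadcastProb_eq, broadcastProb_eq, mul_assoc]
  congr 1
  have h1 : ∏ w : treeBall N (n + 1), (if w.1 = [] then 1 else
      channel q lam (σ ⟨w.1.tail, tail_mem_treeBall w.2⟩) (σ w)) =
      ∏ w ∈ treeBall N (n + 1), F w := by
    rw [← Finset.prod_coe_sort (treeBall N (n + 1)) F]
    refine Finset.prod_congr rfl fun w _ => ?_
    simp [F]
  have h2 : ∏ w ∈ treeBall N (n + 1), F w =
      (∏ w : treeBall N n, F w) * ∏ w : treeLevel N (n + 1), F w := by
    rw [treeBall_succ, Finset.prod_union (disjoint_treeBall_treeLevel N n),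
      ← Finset.prod_coe_sort (treeBall N n), ← Finset.prod_coe_sort (treeLevel N (n + 1))]
  rw [h1, h2]
  congr 1
  · refine Finset.prod_congr rfl fun w _ => ?_
    simp [F, treeBall_subset_succ N n w.2]
  · refine Finset.prod_congr rfl fun w _ => ?_
    have h2 : w.1 ≠ [] := by
      intro h
      have := length_of_mem_treeLevel w.2
      simp [h] at this
    simp [F, h2, treeLevel_subset_treeBall N le_rfl w.2]

/-- The joint weight of the root label `i` and the labels `τ` of the level `n`. -/
def levelWeight (q : ℕ) (lam : ℝ) (N : List ℕ → ℕ) (n : ℕ) (i : Fin q)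
    (τ : treeLevel N n → Fin q) : ℝ :=
  ∑ σ : treeBall N n → Fin q with
      σ ⟨[], root_mem_treeBall N n⟩ = i ∧
        ∀ v : treeLevel N n, σ ⟨v.1, treeLevel_subset_treeBall N le_rfl v.2⟩ = τ v,
      broadcastProb q lam N n σ

theorem sum_levelWeight_mul (q : ℕ) (lam : ℝ) (N : List ℕ → ℕ) (n : ℕ) (i : Fin q)
    (f : (treeLevel N n → Fin q) → ℝ) :
    ∑ τ, levelWeight q lam N n i τ * f τ =
      ∑ σ : treeBall N n → Fin q with σ ⟨[], root_mem_treeBall N n⟩ = i,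
        broadcastProb q lam N n σ *
          f fun v => σ ⟨v.1, treeLevel_subset_treeBall N le_rfl v.2⟩ := by
  rw [← Finset.sum_fiberwise (Finset.univ.filter fun σ : treeBall N n → Fin q =>
    σ ⟨[], root_mem_treeBall N n⟩ = i)
    (fun σ (v : treeLevel N n) => σ ⟨v.1, treeLevel_subset_treeBall N le_rfl v.2⟩)]
  refine Finset.sum_congr rfl fun τ _ => ?_
  rw [levelWeight, Finset.sum_mul, Finset.filter_filter]
  refine Finset.sum_congr ?_ ?_
  · ext σ
    simp only [Finset.mem_filter, Finset.mem_univ, true_and, funext_iff]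
  · intro σ hσ
    congr 2
    exact (Finset.mem_filter.1 hσ).2.2.symm

/-- The Markov property: given the ball of radius n, the next level depends only on level n. -/
theorem levelWeight_succ (q : ℕ) (lam : ℝ) (N : List ℕ → ℕ) (n : ℕ) (i : Fin q)
    (τ' : treeLevel N (n + 1) → Fin q) :
    levelWeight q lam N (n + 1) i τ' =
      ∑ τ, levelWeight q lam N n i τ * ∏ w : treeLevel N (n + 1),
        channel q lam (τ ⟨w.1.tail, tail_mem_treeLevel w.2⟩) (τ' w) := by
  rw [sum_levelWeight_mul, levelWeight]
  have hmem : ∀ w : treeBall N (n + 1), w.1 ∉ treeBall N n → w.1 ∈ treeLevel N (n + 1) := by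
    intro w hw
    exact (Finset.mem_union.1 (treeBall_succ N n ▸ w.2)).resolve_left hw
  refine Finset.sum_bij' (fun σ _ w => σ ⟨w.1, treeBall_subset_succ N n w.2⟩)
    (fun σ _ w => if h : w.1 ∈ treeBall N n then σ ⟨w.1, h⟩ else τ' ⟨w.1, hmem w h⟩) ?_ ?_ ?_ ?_ ?_
  · intro σ hσ
    simp only [Finset.mem_filter, Finset.mem_univ, true_and] at hσ ⊢
    exact hσ.1
  · intro σ hσ
    simp only [Finset.mem_filter, Finset.mem_univ, true_and] at hσ ⊢
    refine ⟨by simpa [root_mem_treeBall] using hσ, fun v => ?_⟩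
    have : v.1 ∉ treeBall N n := fun h =>
      Finset.disjoint_left.1 (disjoint_treeBall_treeLevel N n) h v.2
    simp [this]
  · intro σ hσ
    simp only [Finset.mem_filter, Finset.mem_univ, true_and] at hσ
    funext w
    dsimp only
    split_ifs with h
    · rfl
    · exact (hσ.2 ⟨w.1, hmem w h⟩).symm
  · intro σ _
    funext w
    simp
  · intro σ hσ
    simp only [Finset.mem_filter, Finset.mem_univ, true_and] at hσ
    rw [broadcastProb_succ]
    congr 1
    refine Finset.prod_congr rfl fun w _ => ?_
    rw [hσ.2 w]

theorem sum_levelWeight (q : ℕ) (hq : q ≠ 0) (lam : ℝ) (N : List ℕ → ℕ) (n : ℕ) (i : Fin q) :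
    ∑ τ, levelWeight q lam N (n + 1) i τ = ∑ τ, levelWeight q lam N n i τ := by
  simp only [levelWeight_succ]
  rw [Finset.sum_comm]
  refine Finset.sum_congr rfl fun τ _ => ?_
  have := (Finset.prod_univ_sum (fun _ : treeLevel N (n + 1) => (Finset.univ : Finset (Fin q)))
    fun w j => channel q lam (τ ⟨w.1.tail, tail_mem_treeLevel w.2⟩) j).symm
  rw [Fintype.piFinset_univ] at this
  rw [← Finset.mul_sum, this, Finset.prod_eq_one fun w _ => sum_channel hq lam _, mul_one]

theorem levelWeight_zero (q : ℕ) (lam : ℝ) (N : List ℕ → ℕ) (i : Fin q)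
    (τ : treeLevel N 0 → Fin q) :
    levelWeight q lam N 0 i τ =
      if τ ⟨[], Finset.mem_singleton_self _⟩ = i then 1 / (q : ℝ) else 0 := by
  have hroot : ∀ w : treeBall N 0, w.1 = [] := by
    intro w
    obtain ⟨m, hm, hw⟩ := mem_treeBall.1 w.2
    obtain rfl : m = 0 := by omega
    exact Finset.mem_singleton.1 hw
  have hroot' : ∀ w : treeLevel N 0, w = ⟨[], Finset.mem_singleton_self _⟩ := fun w =>
    Subtype.ext (Finset.mem_singleton.1 w.2)
  have hb : ∀ σ : treeBall N 0 → Fin q, broadcastProb q lam N 0 σ = 1 / q := by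
    intro σ
    rw [broadcastProb_eq, Finset.prod_eq_one, mul_one]
    intro w _
    rw [if_pos (hroot w)]
  have hconst : ∀ (σ : treeBall N 0 → Fin q) (w : treeBall N 0),
      σ w = σ ⟨[], root_mem_treeBall N 0⟩ := fun σ w => congrArg σ (Subtype.ext (hroot w))
  rw [levelWeight]
  split_ifs with h
  · rw [Finset.sum_eq_single (fun _ => i)]
    · exact hb _
    · intro σ hσ hne
      refine absurd (funext fun w => ?_) hne
      exact (hconst σ w).trans (Finset.mem_filter.1 hσ).2.1
    · intro hn
      refine absurd (Finset.mem_filter.2 ⟨Finset.mem_univ _, rfl, fun v => ?_⟩) hn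
      rw [hroot' v, h]
  · refine Finset.sum_eq_zero fun σ hσ => absurd ?_ h
    obtain ⟨-, h1, h2⟩ := Finset.mem_filter.1 hσ
    rw [← h2, ← h1]

theorem sum_levelWeight_eq (q : ℕ) (hq : q ≠ 0) (lam : ℝ) (N : List ℕ → ℕ) (n : ℕ) (i : Fin q) :
    ∑ τ, levelWeight q lam N n i τ = 1 / q := by
  induction n with
  | zero =>
    simp only [levelWeight_zero]
    rw [Finset.sum_eq_single (fun _ => i)]
    · simp
    · intro τ _ hne
      rw [if_neg]
      intro h
      refine hne (funext fun w => ?_)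
      rw [← h]
      exact congrArg τ (Subtype.ext (Finset.mem_singleton.1 w.2))
    · simp
  | succ n ih => rw [sum_levelWeight q hq, ih]

/-- The conditioning event has probability 1/q, as the channel preserves mass from level to level.
-/
theorem levelLaw_eq (q : ℕ) (hq : q ≠ 0) (lam : ℝ) (N : List ℕ → ℕ) (n : ℕ) (i : Fin q)
    (τ : treeLevel N n → Fin q) :
    levelLaw q lam N n i τ = q * levelWeight q lam N n i τ := by
  have h := sum_levelWeight_mul q lam N n i fun _ => 1
  simp only [mul_one, sum_levelWeight_eq q hq] at h
  rw [levelLaw, ← h, levelWeight]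
  field_simp

/-- The point masses at `i` and `j`, with opposite signs, at the root of a tree. -/
def rootState {q : ℕ} (i j : Fin q) : ForestState q where
  level := {[]}
  weight := fun τ => (if τ ⟨[], Finset.mem_singleton_self _⟩ = i then 1 else 0) -
    if τ ⟨[], Finset.mem_singleton_self _⟩ = j then 1 else 0
  removed := 0

theorem pushLabels_levelLaw (q : ℕ) (hq : q ≠ 0) (lam : ℝ) (N : List ℕ → ℕ) (n : ℕ)
    (i j : Fin q) :
    pushLabels q lam (treeLevel N n) (treeLevel N (n + 1))
      (fun τ => levelLaw q lam N n i τ - levelLaw q lam N n j τ) =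
      fun τ => levelLaw q lam N (n + 1) i τ - levelLaw q lam N (n + 1) j τ := by
  funext τ'
  simp only [pushLabels, levelLaw_eq q hq, levelWeight_succ]
  rw [Finset.mul_sum, Finset.mul_sum, ← Finset.sum_sub_distrib]
  refine Finset.sum_congr rfl fun τ _ => ?_
  have : ∀ w : treeLevel N (n + 1), (if h : w.1.tail ∈ treeLevel N n then
      channel q lam (τ ⟨w.1.tail, h⟩) (τ' w) else 1 / (q : ℝ)) =
      channel q lam (τ ⟨w.1.tail, tail_mem_treeLevel w.2⟩) (τ' w) := fun w =>
    dif_pos (tail_mem_treeLevel w.2)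
  simp only [this]
  ring

/-- The exploration started from the two opposite point masses carries exactly the difference of the
level laws. The count of removed vertices does not affect the mass and is left unspecified. -/
theorem exploredState_rootState {q : ℕ} (hq : q ≠ 0) (lam : ℝ) (N : List ℕ → ℕ) (i j : Fin q)
    (m : ℕ) : ∃ K, exploredState lam (rootState i j) N m =
      ⟨treeLevel N m, fun τ => levelLaw q lam N m i τ - levelLaw q lam N m j τ, K⟩ := by
  induction m with
  | zero =>
    refine ⟨0, ?_⟩
    have hq' : (q : ℝ) ≠ 0 := by exact_mod_cast hq
    have h : (fun τ => levelLaw q lam N 0 i τ - levelLaw q lam N 0 j τ) =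
        (rootState i j).weight := by
      funext τ
      have e : (rootState i j).weight τ =
          (if τ ⟨[], Finset.mem_singleton_self _⟩ = i then 1 else 0) -
            if τ ⟨[], Finset.mem_singleton_self _⟩ = j then 1 else 0 := rfl
      rw [e, levelLaw_eq q hq, levelLaw_eq q hq, levelWeight_zero, levelWeight_zero]
      congr 1 <;> split_ifs <;> simp [hq']
    rw [h]
    rfl
  | succ m ih =>
    obtain ⟨K, hK⟩ := ih
    refine ⟨K + (treeLevel N m).card, ?_⟩
    rw [exploredState, hK, ← pushLabels_levelLaw q hq]
    rfl

theorem sum_abs_exploredState {q : ℕ} (hq : q ≠ 0) (lam : ℝ) (N : List ℕ → ℕ) (i j : Fin q)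
    (m : ℕ) : ∑ τ, |(exploredState lam (rootState i j) N m).weight τ| =
      2 * tvDist (levelLaw q lam N m i) (levelLaw q lam N m j) := by
  obtain ⟨K, hK⟩ := exploredState_rootState hq lam N i j m
  rw [hK, tvDist]
  ring

/-! ### Consequences of nonreconstruction -/

theorem sum_abs_rootState_le {q : ℕ} (i j : Fin q) :
    ∑ τ, |(rootState i j).weight τ| ≤ 2 := by
  have e : ∑ τ, |(rootState i j).weight τ| ≤ ∑ τ : ({[]} : Finset (List ℕ)) → Fin q,
      ((if τ ⟨[], Finset.mem_singleton_self _⟩ = i then (1 : ℝ) else 0) +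
        if τ ⟨[], Finset.mem_singleton_self _⟩ = j then 1 else 0) := by
    refine Finset.sum_le_sum fun τ _ => ?_
    simp only [rootState]
    split_ifs <;> norm_num
  have e2 : ∀ k : Fin q, ∑ τ : ({[]} : Finset (List ℕ)) → Fin q,
      (if τ ⟨[], Finset.mem_singleton_self _⟩ = k then (1 : ℝ) else 0) = 1 := by
    intro k
    rw [Finset.sum_eq_single (fun _ => k)]
    · simp
    · intro τ _ hne
      rw [if_neg]
      intro h
      refine hne (funext fun w => ?_)
      rw [← h]
      exact congrArg τ (Subtype.ext (Finset.mem_singleton.1 w.2))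
    · simp
  rw [Finset.sum_add_distrib, e2, e2] at e
  linarith

/-- The distances lie in [0, 1], so the real-valued `limsup` is a genuine one; being at most 0, it
forces convergence. -/
theorem tendsto_tvDist_of_nonreconstruction {q : ℕ} (hq : q ≠ 0) {lam : ℝ}
    (hch : ∀ i j, 0 ≤ channel q lam i j) {N : List ℕ → ℕ} (h : Nonreconstruction q lam N)
    (i j : Fin q) :
    Tendsto (fun n => tvDist (levelLaw q lam N n i) (levelLaw q lam N n j)) atTop (nhds 0) := by
  have h0 : ∀ n, 0 ≤ tvDist (levelLaw q lam N n i) (levelLaw q lam N n j) := fun n =>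
    mul_nonneg (by norm_num) (Finset.sum_nonneg fun _ _ => abs_nonneg _)
  have h1 : ∀ n, tvDist (levelLaw q lam N n i) (levelLaw q lam N n j) ≤ 1 := fun n => by
    have := sum_abs_exploredState_le hq hch (sum_abs_rootState_le i j) N n
    rw [sum_abs_exploredState hq] at this
    linarith
  have hl : limsup (fun n => tvDist (levelLaw q lam N n i) (levelLaw q lam N n j)) atTop ≤ 0 :=
    not_lt.1 fun hlt => h ⟨i, j, hlt⟩
  have hbdd : IsBoundedUnder (· ≤ ·) atTop
      (fun n => tvDist (levelLaw q lam N n i) (levelLaw q lam N n j)) :=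
    isBoundedUnder_of ⟨1, h1⟩
  have hbdd' : IsBoundedUnder (· ≥ ·) atTop
      (fun n => tvDist (levelLaw q lam N n i) (levelLaw q lam N n j)) :=
    isBoundedUnder_of ⟨0, h0⟩
  refine tendsto_of_le_liminf_of_limsup_le ?_ hl hbdd hbdd'
  exact le_liminf_of_le hbdd.isCoboundedUnder_ge (Eventually.of_forall h0)

/-- Dominated convergence, with bound 2, turns nonreconstruction on almost every tree into
convergence of the mean. -/
theorem tendsto_forestNorm_rootState {q : ℕ} (hq : q ≠ 0) {a b d lam : ℝ} (ha : 0 ≤ a)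
    (hb : 0 ≤ b) (hd : (a + ((q : ℝ) - 1) * b) / q = d) (hd0 : 0 ≤ d)
    (hch : ∀ i j : Fin q, edgeProb a b i j = d * (q * channel q lam i j))
    (hch0 : ∀ i j, 0 ≤ channel q lam i j)
    (hnonrec : ∀ᵐ N ∂(poissonGW d.toNNReal), Nonreconstruction q lam N)
    {h : Fin q → ℝ} (hh : ∀ i, |h i| ≤ 1) (i j : Fin q) :
    Tendsto (fun n : ℕ => forestNorm n (a / n) (b / n) h (rootState i j)) atTop (nhds 0) := by
  refine tendsto_forestNorm hq ha hb (c := max a b) (le_max_left _ _) (le_max_right _ _) hd hd0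
    hch hch0 hh rfl (sum_abs_rootState_le i j) ?_
  have hz : ∫⁻ _ : List ℕ → ℕ, (0 : ENNReal) ∂poissonGW d.toNNReal = 0 := lintegral_zero
  rw [← hz]
  refine tendsto_lintegral_of_dominated_convergence (fun _ => 2)
    (fun m => measurable_comp_exploredState (fun s' => ENNReal.ofReal (∑ τ, |s'.weight τ|))
      lam (rootState i j) m)
    (fun m => Eventually.of_forall fun N => ?_) (by simp) ?_
  · calc _ ≤ ENNReal.ofReal 2 := ENNReal.ofReal_le_ofReal
          (sum_abs_exploredState_le hq hch0 (sum_abs_rootState_le i j) N m)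
      _ = 2 := by simp
  · filter_upwards [hnonrec] with N hN
    simp only [sum_abs_exploredState hq]
    have := ((tendsto_tvDist_of_nonreconstruction hq hch0 hN i j).const_mul 2)
    have h2 := (ENNReal.continuous_ofReal.tendsto _).comp this
    rw [mul_zero, ENNReal.ofReal_zero] at h2
    exact h2

/-! ### Expectations over the block model -/

/-- Expectation over the labels and the set of edges of the block model. -/
def edgeExpectation {n q : ℕ} (pin pout : ℝ)
    (f : (Fin n → Fin q) → Finset (Fin n × Fin n) → ℝ) : ℝ :=
  ∑ H ∈ (pairsIn (Finset.univ : Finset (Fin n))).powerset,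
    labelAvg fun σ => f σ H * edgeWeight pin pout (pairsIn Finset.univ) H σ

/-- The graph with a given set of edges. -/
def graphOfEdges {n : ℕ} (H : Finset (Fin n × Fin n)) : SimpleGraph (Fin n) :=
  SimpleGraph.fromRel fun x y => (x, y) ∈ H

theorem sum_simpleGraph {n : ℕ} (K : SimpleGraph (Fin n) → ℝ) :
    ∑ G, K G = ∑ H ∈ (pairsIn (Finset.univ : Finset (Fin n))).powerset, K (graphOfEdges H) := by
  have hinv : ∀ G : SimpleGraph (Fin n),
      graphOfEdges ((pairsIn Finset.univ).filter fun p => G.Adj p.1 p.2) = G := by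
    intro G
    ext x y
    simp only [graphOfEdges, SimpleGraph.fromRel_adj, Finset.mem_filter, mem_pairsIn,
      Finset.mem_univ, and_true]
    constructor
    · rintro ⟨-, ⟨-, h⟩ | ⟨-, h⟩⟩
      · exact h
      · exact h.symm
    · intro h
      refine ⟨h.ne, ?_⟩
      rcases lt_or_gt_of_ne h.ne with hlt | hlt
      · exact Or.inl ⟨hlt, h⟩
      · exact Or.inr ⟨hlt, h.symm⟩
  refine Finset.sum_nbij' (fun G => (pairsIn Finset.univ).filter fun p => G.Adj p.1 p.2)
    graphOfEdges ?_ ?_ ?_ ?_ ?_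
  · intro G _
    exact Finset.mem_powerset.2 (Finset.filter_subset _ _)
  · intro H _
    exact Finset.mem_univ _
  · intro G _
    exact hinv G
  · intro H hH
    rw [Finset.mem_powerset] at hH
    ext p
    simp only [Finset.mem_filter, graphOfEdges, SimpleGraph.fromRel_adj]
    constructor
    · rintro ⟨hp, -, h | h⟩
      · exact h
      · exact absurd (mem_pairsIn.1 (hH h)).1 (mem_pairsIn.1 hp).1.asymm
    · intro h
      exact ⟨hH h, (mem_pairsIn.1 (hH h)).1.ne, Or.inl h⟩
  · intro G _
    rw [hinv]

theorem sbmExpectation_eq {n q : ℕ} (pin pout : ℝ)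
    (f : (Fin n → Fin q) → SimpleGraph (Fin n) → ℝ) :
    sbmExpectation n q pin pout f =
      edgeExpectation pin pout fun σ H => f σ (graphOfEdges H) := by
  unfold sbmExpectation edgeExpectation labelAvg
  simp only [sum_simpleGraph]
  rw [Finset.sum_comm]
  refine Finset.sum_congr rfl fun H hH => ?_
  rw [Finset.mem_powerset] at hH
  rw [Finset.mul_sum]
  refine Finset.sum_congr rfl fun σ _ => ?_
  have h : sbmProb n q pin pout σ (graphOfEdges H) =
      (1 / (q : ℝ)) ^ n * edgeWeight pin pout (pairsIn Finset.univ) H σ := by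
    unfold sbmProb edgeWeight
    congr 1
    have hset : (Finset.univ.filter fun e : Fin n × Fin n => e.1 < e.2) =
        pairsIn Finset.univ := by
      ext e; simp [mem_pairsIn]
    rw [hset]
    refine Finset.prod_congr rfl fun e he => ?_
    have hadj : (graphOfEdges H).Adj e.1 e.2 ↔ e ∈ H := by
      simp only [graphOfEdges, SimpleGraph.fromRel_adj]
      constructor
      · rintro ⟨-, h | h⟩
        · exact h
        · exact absurd (mem_pairsIn.1 (hH h)).1 (mem_pairsIn.1 he).1.asymm
      · intro h
        exact ⟨(mem_pairsIn.1 he).1.ne, Or.inl h⟩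
    simp only [hadj, edgeProb]
  rw [h]
  ring

section EdgeExpectation

variable {n q : ℕ} {pin pout : ℝ}

theorem edgeExpectation_mono (hin : 0 ≤ pin) (hout : 0 ≤ pout) (hin1 : pin ≤ 1)
    (hout1 : pout ≤ 1) {f g : (Fin n → Fin q) → Finset (Fin n × Fin n) → ℝ}
    (h : ∀ σ H, f σ H ≤ g σ H) : edgeExpectation pin pout f ≤ edgeExpectation pin pout g :=
  Finset.sum_le_sum fun _ _ => labelAvg_mono fun _ =>
    mul_le_mul_of_nonneg_right (h _ _) (edgeWeight_nonneg hin hout hin1 hout1 _ _ _)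

theorem edgeExpectation_add (f g : (Fin n → Fin q) → Finset (Fin n × Fin n) → ℝ) :
    edgeExpectation pin pout (fun σ H => f σ H + g σ H) =
      edgeExpectation pin pout f + edgeExpectation pin pout g := by
  unfold edgeExpectation
  rw [← Finset.sum_add_distrib]
  refine Finset.sum_congr rfl fun H _ => ?_
  rw [← labelAvg_add]
  simp only [add_mul]

theorem edgeExpectation_const_mul (c : ℝ)
    (f : (Fin n → Fin q) → Finset (Fin n × Fin n) → ℝ) :
    edgeExpectation pin pout (fun σ H => c * f σ H) = c * edgeExpectation pin pout f := by
  unfold edgeExpectation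
  rw [Finset.mul_sum]
  refine Finset.sum_congr rfl fun H _ => ?_
  rw [← labelAvg_const_mul]
  simp only [mul_assoc]

theorem edgeExpectation_sum {ι : Type*} (s : Finset ι)
    (f : ι → (Fin n → Fin q) → Finset (Fin n × Fin n) → ℝ) :
    edgeExpectation pin pout (fun σ H => ∑ i ∈ s, f i σ H) =
      ∑ i ∈ s, edgeExpectation pin pout (f i) := by
  unfold edgeExpectation
  rw [Finset.sum_comm]
  refine Finset.sum_congr rfl fun H _ => ?_
  rw [← labelAvg_sum]
  simp only [Finset.sum_mul]

theorem edgeExpectation_const (hq : q ≠ 0) (c : ℝ) :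
    edgeExpectation pin pout (fun (_ : Fin n → Fin q) _ => c) = c := by
  unfold edgeExpectation
  rw [← labelAvg_sum]
  simp only [← Finset.mul_sum, sum_edgeWeight, mul_one]
  exact labelAvg_const hq c

/-- Indicator of the label `t`. -/
def labelIndicator (t c : Fin q) : ℝ :=
  if c = t then 1 else 0

/-- The signed density comparing the labels `i` and `j` of the vertex `u`, when `v` has the
label `t`. -/
def labelContrast (u v : Fin n) (i j t : Fin q) (σ : Fin n → Fin q) : ℝ :=
  q * ((if σ u = i then 1 else 0) - if σ u = j then 1 else 0) * if σ v = t then 1 else 0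

/-- The starting point of the exploration: the level is the root alone, placed at `u`, and nothing
has been removed. -/
theorem graphNorm_labelContrast_le {u v : Fin n} (huv : u ≠ v) (i j t : Fin q) :
    ENNReal.ofReal (graphNorm pin pout (pairsIn Finset.univ) (labelContrast u v i j t)) ≤
      forestNorm n pin pout (labelIndicator t) (rootState i j) := by
  refine le_trans (le_of_eq ?_) (le_forestNorm (s := rootState i j) (U := Finset.univ) (v := v)
    (φ := fun _ => u) ?_ (fun _ _ => ⟨Finset.mem_univ _, huv⟩) ?_)
  · congr 2
    funext σ
    simp [labelContrast, rootState, labelIndicator]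
  · intro w hw w' hw' _
    simp only [rootState, Finset.coe_singleton, Set.mem_singleton_iff] at hw hw'
    rw [hw, hw']
  · simp

/-- The covariance of the agreements of an estimator with the labels at two vertices. -/
theorem edgeExpectation_agreement_le (hq : q ≠ 0)
    (r : Finset (Fin n × Fin n) → Fin n → Fin q) (u v : Fin n) :
    edgeExpectation pin pout (fun σ H => ((if σ u = r H u then (1 : ℝ) else 0) - 1 / q) *
      ((if σ v = r H v then (1 : ℝ) else 0) - 1 / q)) ≤
    ∑ i, ∑ j, ∑ t, graphNorm pin pout (pairsIn Finset.univ)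
      (labelContrast (q := q) u v i j t) := by
  have hq' : (q : ℝ) ≠ 0 := by exact_mod_cast hq
  have hq1 : (1 : ℝ) ≤ q := by exact_mod_cast Nat.one_le_iff_ne_zero.2 hq
  have hq2 : (1 / (q : ℝ)) ≤ 1 := by rw [div_le_one (by linarith)]; exact hq1
  have hq0 : (0 : ℝ) ≤ 1 / q := by positivity
  -- The first centred indicator is the average over j of the differences of the indicators of i and
  -- j; the second is expanded over the value t of σ v. The coefficients are at most 1 in absolute
  -- value.
  have hdec : ∀ (σ : Fin n → Fin q) (i k : Fin q), ((if σ u = i then (1 : ℝ) else 0) - 1 / q) *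
      ((if σ v = k then (1 : ℝ) else 0) - 1 / q) =
      ∑ j, ∑ t, ((1 / (q : ℝ)) ^ 2 * ((if t = k then 1 else 0) - 1 / q)) *
        labelContrast u v i j t σ := by
    intro σ i k
    have e1 : (if σ u = i then (1 : ℝ) else 0) - 1 / q = ∑ j, (1 / (q : ℝ)) *
        ((if σ u = i then 1 else 0) - if σ u = j then 1 else 0) := by
      rw [← Finset.mul_sum, Finset.sum_sub_distrib]
      simp only [Finset.sum_const, Finset.card_univ, Fintype.card_fin, nsmul_eq_mul,
        Finset.sum_ite_eq, Finset.mem_univ, if_true]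
      field_simp
    have e2 : (if σ v = k then (1 : ℝ) else 0) - 1 / q = ∑ t,
        ((if t = k then 1 else 0) - 1 / (q : ℝ)) * if σ v = t then 1 else 0 := by
      simp
    rw [e1, e2, Finset.sum_mul_sum]
    refine Finset.sum_congr rfl fun j _ => Finset.sum_congr rfl fun t _ => ?_
    unfold labelContrast
    field_simp
  have hcoef : ∀ t k : Fin q, |(1 / (q : ℝ)) ^ 2 * ((if t = k then (1 : ℝ) else 0) - 1 / q)| ≤
      1 := by
    intro t k
    rw [abs_mul, abs_of_nonneg (by positivity : (0 : ℝ) ≤ (1 / q) ^ 2)]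
    refine mul_le_one₀ (pow_le_one₀ hq0 hq2) (abs_nonneg _) ?_
    rw [abs_le]
    split_ifs <;> constructor <;> linarith
  unfold edgeExpectation graphNorm
  have hswap : ∑ i : Fin q, ∑ j : Fin q, ∑ t : Fin q,
      ∑ H ∈ (pairsIn (Finset.univ : Finset (Fin n))).powerset,
        |labelAvg fun σ => labelContrast u v i j t σ *
          edgeWeight pin pout (pairsIn Finset.univ) H σ| =
      ∑ H ∈ (pairsIn (Finset.univ : Finset (Fin n))).powerset, ∑ i : Fin q, ∑ j : Fin q,
        ∑ t : Fin q, |labelAvg fun σ => labelContrast u v i j t σ *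
          edgeWeight pin pout (pairsIn Finset.univ) H σ| := by
    symm
    rw [Finset.sum_comm]
    refine Finset.sum_congr rfl fun i _ => ?_
    rw [Finset.sum_comm]
    refine Finset.sum_congr rfl fun j _ => ?_
    rw [Finset.sum_comm]
  rw [hswap]
  refine Finset.sum_le_sum fun H _ => ?_
  -- The estimated label `r H u` varies with the graph, which is why the bound sums over all i: for
  -- each `H` only the term i = `r H u` is needed.
  refine le_trans ?_ (Finset.single_le_sum (f := fun i => ∑ j : Fin q, ∑ t : Fin q,
    |labelAvg fun σ => labelContrast u v i j t σ *
      edgeWeight pin pout (pairsIn Finset.univ) H σ|)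
    (fun _ _ => Finset.sum_nonneg fun _ _ => Finset.sum_nonneg fun _ _ => abs_nonneg _)
    (Finset.mem_univ (r H u)))
  simp only [hdec, Finset.sum_mul, labelAvg_sum, mul_assoc ((1 / (q : ℝ)) ^ 2 * _)]
  refine Finset.sum_le_sum fun j _ => Finset.sum_le_sum fun t _ => ?_
  rw [labelAvg_const_mul]
  refine (le_abs_self _).trans ?_
  rw [abs_mul]
  exact mul_le_of_le_one_left (abs_nonneg _) (hcoef _ _)

end EdgeExpectation

/-! ### Overlap of an estimator -/

/-- Centered agreement of the labellings `s` and `σ` up to the permutation `Γ`. -/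
def centeredAgreement {n q : ℕ} (s σ : Fin n → Fin q) (Γ : Equiv.Perm (Fin q)) : ℝ :=
  ∑ u, ((if σ u = Γ.symm (s u) then (1 : ℝ) else 0) - 1 / q)

theorem card_agreement {n q : ℕ} (s σ : Fin n → Fin q) (Γ : Equiv.Perm (Fin q)) :
    ((Finset.univ.filter fun i : Fin n => s i = Γ (σ i)).card : ℝ) =
      n / q + centeredAgreement s σ Γ := by
  unfold centeredAgreement
  rw [Finset.sum_sub_distrib, Finset.card_filter]
  push_cast
  have : ∀ u, (if σ u = Γ.symm (s u) then (1 : ℝ) else 0) = if s u = Γ (σ u) then 1 else 0 := by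
    intro u
    simp only [Equiv.eq_symm_apply, eq_comm]
  simp only [this, Finset.sum_const, Finset.card_univ, Fintype.card_fin, nsmul_eq_mul]
  ring

/-- The maximum is replaced by a sum over q! permutations, a number independent of n. -/
theorem maxAgreement_le {n q : ℕ} (s σ : Fin n → Fin q) :
    (maxAgreement s σ : ℝ) ≤ n / q + ∑ Γ, |centeredAgreement s σ Γ| := by
  obtain ⟨Γ, -, hΓ⟩ := Finset.exists_mem_eq_sup (Finset.univ : Finset (Equiv.Perm (Fin q)))
    Finset.univ_nonempty fun Γ => (Finset.univ.filter fun i : Fin n => s i = Γ (σ i)).card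
  rw [maxAgreement, hΓ, card_agreement]
  gcongr
  exact (le_abs_self _).trans (Finset.single_le_sum
    (f := fun Γ => |centeredAgreement s σ Γ|) (fun _ _ => abs_nonneg _) (Finset.mem_univ Γ))

/-- Among the q cyclic shifts of the labels, each vertex agrees for exactly one, so some shift has
at least n/q agreements. -/
theorem le_maxAgreement {n q : ℕ} (hq : q ≠ 0) (s σ : Fin n → Fin q) :
    (n : ℝ) / q ≤ maxAgreement s σ := by
  have : NeZero q := ⟨hq⟩
  have h1 : ∀ c : Fin q, (Finset.univ.filter fun i : Fin n => s i = σ i + c).card ≤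
      maxAgreement s σ := fun c =>
    Finset.le_sup (f := fun Γ : Equiv.Perm (Fin q) =>
      (Finset.univ.filter fun i : Fin n => s i = Γ (σ i)).card)
      (Finset.mem_univ (Equiv.addRight c))
  have h2 : ∑ c : Fin q, (Finset.univ.filter fun i : Fin n => s i = σ i + c).card = n := by
    simp only [Finset.card_filter]
    rw [Finset.sum_comm]
    have : ∀ i, ∑ c : Fin q, (if s i = σ i + c then 1 else 0) = 1 := by
      intro i
      rw [Finset.sum_eq_single (s i - σ i)]
      · simp
      · intro c _ hc
        rw [if_neg]
        intro h
        exact hc (by rw [h]; simp)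
      · simp
    simp [this]
  have h3 : n ≤ q * maxAgreement s σ := by
    calc n = _ := h2.symm
      _ ≤ ∑ _c : Fin q, maxAgreement s σ := Finset.sum_le_sum fun c _ => h1 c
      _ = _ := by simp
  rw [div_le_iff₀ (by positivity)]
  rw [mul_comm] at h3
  exact_mod_cast h3

/-- Second moment method: the diagonal contributes at most n and each off-diagonal pair at most `D`;
then |y| ≤ nθ + y²/(nθ) passes to the first moment. -/
theorem edgeExpectation_centeredAgreement_le {n q : ℕ} (hq : q ≠ 0) (hn : n ≠ 0)
    {pin pout : ℝ} (hin : 0 ≤ pin) (hout : 0 ≤ pout) (hin1 : pin ≤ 1) (hout1 : pout ≤ 1)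
    (s : Finset (Fin n × Fin n) → Fin n → Fin q) (Γ : Equiv.Perm (Fin q)) {D θ : ℝ} (hθ : 0 < θ)
    (hD0 : 0 ≤ D)
    (hD : ∀ u v : Fin n, u ≠ v → ∑ i, ∑ j, ∑ t, graphNorm pin pout (pairsIn Finset.univ)
      (labelContrast (q := q) u v i j t) ≤ D) :
    edgeExpectation pin pout (fun σ H => |centeredAgreement (s H) σ Γ|) ≤
      n * (θ + (1 / n + D) / θ) := by
  have hn' : (0 : ℝ) < n := by positivity
  have hq' : (0 : ℝ) < q := by positivity
  have hq1 : (1 : ℝ) ≤ q := by exact_mod_cast Nat.one_le_iff_ne_zero.2 hq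
  have hq2 : (1 / (q : ℝ)) ≤ 1 := by rw [div_le_one hq']; exact hq1
  have hq0 : (0 : ℝ) ≤ 1 / q := by positivity
  have hsq : edgeExpectation pin pout (fun σ H => centeredAgreement (s H) σ Γ ^ 2) ≤
      n + n ^ 2 * D := by
    have hexp : ∀ (σ : Fin n → Fin q) (H : Finset (Fin n × Fin n)),
        centeredAgreement (s H) σ Γ ^ 2 = ∑ u, ∑ v,
          ((if σ u = Γ.symm (s H u) then (1 : ℝ) else 0) - 1 / q) *
            ((if σ v = Γ.symm (s H v) then (1 : ℝ) else 0) - 1 / q) := by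
      intro σ H
      rw [sq, centeredAgreement, Finset.sum_mul_sum]
    simp only [hexp, edgeExpectation_sum]
    calc _ ≤ ∑ u : Fin n, ∑ v : Fin n, ((if u = v then 1 else 0) + D) := by
          refine Finset.sum_le_sum fun u _ => Finset.sum_le_sum fun v _ => ?_
          split_ifs with huv
          · refine (edgeExpectation_mono hin hout hin1 hout1 (g := fun _ _ => 1)
              fun σ H => ?_).trans ?_
            · subst huv
              split_ifs <;> nlinarith
            · rw [edgeExpectation_const hq]
              linarith
          · rw [zero_add]
            exact (edgeExpectation_agreement_le hq (fun H u => Γ.symm (s H u)) u v).trans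
              (hD u v huv)
      _ = _ := by
          simp [Finset.sum_add_distrib]
          ring
  calc edgeExpectation pin pout (fun σ H => |centeredAgreement (s H) σ Γ|)
      ≤ edgeExpectation pin pout (fun σ H => n * θ +
        (1 / (n * θ)) * centeredAgreement (s H) σ Γ ^ 2) := by
        refine edgeExpectation_mono hin hout hin1 hout1 fun σ H => ?_
        set y := centeredAgreement (s H) σ Γ
        rw [← sq_abs, div_mul_eq_mul_div, one_mul, ← sub_le_iff_le_add',
          le_div_iff₀ (by positivity)]
        nlinarith [sq_nonneg (|y| - n * θ), abs_nonneg y, mul_pos hn' hθ,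
          mul_nonneg (abs_nonneg y) (mul_pos hn' hθ).le]
    _ ≤ n * θ + (1 / (n * θ)) * (n + n ^ 2 * D) := by
        rw [edgeExpectation_add, edgeExpectation_const hq, edgeExpectation_const_mul]
        gcongr
    _ = _ := by
        field_simp

/-- If the labels of two vertices are asymptotically independent given the graph, then every
estimator has a trivial overlap. -/
theorem tendsto_expectedOverlap {q : ℕ} (hq : q ≠ 0) {a b : ℝ} (ha : 0 ≤ a) (hb : 0 ≤ b)
    (D : ℕ → ℝ) (hD0 : ∀ n, 0 ≤ D n) (hDlim : Tendsto D atTop (nhds 0))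
    (hD : ∀ᶠ n : ℕ in atTop, ∀ u v : Fin n, u ≠ v → ∑ i, ∑ j, ∑ t,
      graphNorm (a / n) (b / n) (pairsIn Finset.univ) (labelContrast (q := q) u v i j t) ≤ D n)
    (est : Estimator q) :
    Tendsto (fun n => expectedOverlap q a b est n) atTop (nhds (1 / (q : ℝ))) := by
  have ha1 : ∀ᶠ n : ℕ in atTop, a / n ≤ 1 :=
    (tendsto_const_div_atTop_nhds_zero_nat a).eventually (ge_mem_nhds (by norm_num))
  have hb1 : ∀ᶠ n : ℕ in atTop, b / n ≤ 1 :=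
    (tendsto_const_div_atTop_nhds_zero_nat b).eventually (ge_mem_nhds (by norm_num))
  set P : ℝ := ((Fintype.card (Equiv.Perm (Fin q)) : ℕ) : ℝ) with hP
  have hP0 : 0 < P := by
    rw [hP]
    exact_mod_cast Fintype.card_pos
  rw [tendsto_order]
  constructor
  · intro x hx
    filter_upwards [ha1, hb1, eventually_ne_atTop 0] with n h1 h2 hn
    have hn' : (0 : ℝ) < n := by positivity
    refine hx.trans_le ?_
    rw [expectedOverlap, sbmExpectation_eq]
    have := edgeExpectation_mono (n := n) (q := q) (div_nonneg ha hn'.le) (div_nonneg hb hn'.le)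
      h1 h2 (f := fun _ _ => (n : ℝ) / q)
      (g := fun σ H => (maxAgreement (est n (graphOfEdges H)) σ : ℝ))
      fun σ H => le_maxAgreement hq _ _
    rw [edgeExpectation_const hq] at this
    calc 1 / (q : ℝ) = 1 / n * (n / q) := by field_simp
      _ ≤ _ := by gcongr
  · intro x hx
    -- The choice of θ makes P θ half of the gap between x and 1/q.
    obtain ⟨θ, hθ, hθx⟩ : ∃ θ : ℝ, 0 < θ ∧ 1 / (q : ℝ) + P * θ < x := by
      refine ⟨(x - 1 / q) / (2 * P), by have := sub_pos.2 hx; positivity, ?_⟩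
      have : P * ((x - 1 / q) / (2 * P)) = (x - 1 / q) / 2 := by field_simp
      rw [this]
      linarith
    have hlim : Tendsto (fun n : ℕ => 1 / (q : ℝ) + P * (θ + (1 / (n : ℝ) + D n) / θ)) atTop
        (nhds (1 / (q : ℝ) + P * (θ + (0 + 0) / θ))) :=
      ((((tendsto_const_div_atTop_nhds_zero_nat 1).add hDlim).div_const θ).const_add θ
        |>.const_mul P).const_add _
    have hlt : 1 / (q : ℝ) + P * (θ + (0 + 0) / θ) < x := by simpa using hθx
    filter_upwards [ha1, hb1, eventually_ne_atTop 0, hD, hlim.eventually (gt_mem_nhds hlt)]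
      with n h1 h2 hn hDn hxn
    have hn' : (0 : ℝ) < n := by positivity
    refine lt_of_le_of_lt ?_ hxn
    rw [expectedOverlap, sbmExpectation_eq]
    have h3 := edgeExpectation_mono (n := n) (q := q) (div_nonneg ha hn'.le)
      (div_nonneg hb hn'.le) h1 h2
      (f := fun σ H => (maxAgreement (est n (graphOfEdges H)) σ : ℝ))
      (g := fun σ H => (n : ℝ) / q + ∑ Γ, |centeredAgreement (est n (graphOfEdges H)) σ Γ|)
      fun σ H => maxAgreement_le _ _
    rw [edgeExpectation_add, edgeExpectation_const hq, edgeExpectation_sum] at h3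
    have h4 : ∑ Γ : Equiv.Perm (Fin q), edgeExpectation (n := n) (a / n) (b / n)
        (fun σ H => |centeredAgreement (est n (graphOfEdges H)) σ Γ|) ≤
        P * (n * (θ + (1 / n + D n) / θ)) := by
      calc _ ≤ ∑ _Γ : Equiv.Perm (Fin q), (n : ℝ) * (θ + (1 / n + D n) / θ) :=
            Finset.sum_le_sum fun Γ _ => edgeExpectation_centeredAgreement_le hq hn
              (div_nonneg ha hn'.le) (div_nonneg hb hn'.le) h1 h2
              (fun H => est n (graphOfEdges H)) Γ hθ (hD0 n) hDn
        _ = _ := by rw [Finset.sum_const, nsmul_eq_mul, Finset.card_univ]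
    calc _ ≤ 1 / (n : ℝ) * (n / q + P * (n * (θ + (1 / n + D n) / θ))) := by
          gcongr
          linarith
      _ = _ := by field_simp

end

/-! ### Conclusion. -/

theorem theoremt (q : ℕ) (hq : 2 ≤ q) (a b d lam : ℝ) (ha : 0 ≤ a) (hb : 0 < b)
    (hd : d = (a + ((q : ℝ) - 1) * b) / q)
    (hlam : lam = (a - b) / (a + ((q : ℝ) - 1) * b))
    (hnonrec : ∀ᵐ N ∂(poissonGW d.toNNReal), Nonreconstruction q lam N) :
    ¬ DetectionPossible q a b ∧
      ∀ est : Estimator q,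
        limsup (fun n : ℕ => expectedOverlap q a b est n) atTop = 1 / (q : ℝ) := by
  have hq0 : q ≠ 0 := by omega
  have hq2 : (2 : ℝ) ≤ q := by exact_mod_cast hq
  have hs : 0 < a + ((q : ℝ) - 1) * b := by nlinarith
  have hd0 : 0 < d := by rw [hd]; positivity
  -- The value of `lam` is the one for which the channel entries are a and b divided by a + (q - 1)b
  -- = qd. Nonnegativity of the channel follows from it as well.
  have hch : ∀ i j : Fin q, edgeProb a b i j = d * (q * channel q lam i j) := by
    have h1 : (1 - lam) / q = b / (a + ((q : ℝ) - 1) * b) := by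
      rw [hlam, div_eq_div_iff (by positivity) hs.ne', sub_mul, div_mul_cancel₀ _ hs.ne']
      ring
    have h2 : lam + b / (a + ((q : ℝ) - 1) * b) = a / (a + ((q : ℝ) - 1) * b) := by
      rw [hlam, ← add_div, sub_add_cancel]
    have hcancel : ∀ x s : ℝ, s ≠ 0 → x = s / q * (q * (x / s)) := by
      intro x s hs
      field_simp
    intro i j
    unfold edgeProb channel
    rw [h1, h2, hd]
    split_ifs
    · exact hcancel a _ hs.ne'
    · exact hcancel b _ hs.ne'
  have hch0 : ∀ i j : Fin q, 0 ≤ channel q lam i j := by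
    intro i j
    have h1 := edgeProb_nonneg ha hb.le i j
    rw [hch, ← mul_assoc] at h1
    exact nonneg_of_mul_nonneg_right h1 (by positivity)
  have hh : ∀ t c : Fin q, |labelIndicator t c| ≤ 1 := by
    intro t c
    unfold labelIndicator
    split_ifs <;> simp
  have hlim := fun i j t => tendsto_forestNorm_rootState hq0 ha hb.le hd.symm hd0.le hch hch0
    hnonrec (hh t) i j
  have key : ∀ est : Estimator q,
      Tendsto (fun n => expectedOverlap q a b est n) atTop (nhds (1 / (q : ℝ))) := by
    refine tendsto_expectedOverlap hq0 ha hb.le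
      (fun n => ∑ i : Fin q, ∑ j : Fin q, ∑ t : Fin q, (forestNorm n (a / n) (b / n)
        (labelIndicator t) (rootState i j)).toReal)
      (fun n => Finset.sum_nonneg fun _ _ => Finset.sum_nonneg fun _ _ =>
        Finset.sum_nonneg fun _ _ => ENNReal.toReal_nonneg) ?_ ?_
    · have h0 : (0 : ℝ) = ∑ _i : Fin q, ∑ _j : Fin q, ∑ _t : Fin q, 0 := by simp
      rw [h0]
      refine tendsto_finsetSum _ fun i _ => tendsto_finsetSum _ fun j _ =>
        tendsto_finsetSum _ fun t _ => ?_
      have h1 := (ENNReal.tendsto_toReal ENNReal.zero_ne_top).comp (hlim i j t)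
      rw [ENNReal.toReal_zero] at h1
      exact h1
    · have hfin : ∀ᶠ n : ℕ in atTop, ∀ i j t : Fin q, forestNorm n (a / n) (b / n)
          (labelIndicator t) (rootState i j) < 1 := by
        refine eventually_all.2 fun i => eventually_all.2 fun j => eventually_all.2 fun t => ?_
        exact (tendsto_order.1 (hlim i j t)).2 1 zero_lt_one
      filter_upwards [hfin] with n hn u v huv
      refine Finset.sum_le_sum fun i _ => Finset.sum_le_sum fun j _ =>
        Finset.sum_le_sum fun t _ => ?_
      exact (ENNReal.ofReal_le_iff_le_toReal ((hn i j t).trans ENNReal.one_lt_top).ne).1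
        (graphNorm_labelContrast_le huv i j t)
  refine ⟨?_, fun est => (key est).limsup_eq⟩
  rintro ⟨ε, hε, est, h⟩
  rw [(key est).limsup_eq] at h
  linarith
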